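/- Let $M=(|M|,\mathcal O_M)$ be a real smooth supermanifold of finite dimension $p|q$, with $C^\infty(M)=\mathcal O_M(|M|)$, and let $Q_1,Q_2$ be odd vector fields and $P$ an even vector field on $M$ satisfying the $\mathcal N=2$, $d=1$ supertranslation algebra $$Q_1^2=Q_2^2=0,\qquad Q_1Q_2+Q_2Q_1=P,\qquad [P,Q_1]=[P,Q_2]=0 .$$ A Berezin volume $\boldsymbol\rho$ is a nowhere vanishing even section of the Berezinian bundle, locally $\boldsymbol\rho=D[x]\,\rho(x)$ with $D[x']=D[x]\,\mathrm{Ber}(\partial x'/\partial x)$. The divergence of a vector field $X$ is the function defined by $\boldsymbol\rho\,\mathrm{Div}_{\boldsymbol\rho}X=L_X\boldsymbol\rho$, locally $\mathrm{Div}_{\boldsymbol\rho}X=\sum_a(-1)^{\widetilde a(\widetilde X+1)}\frac1\rho\frac{\partial (X^a\rho)}{\partial x^a}$. Suppose that $M$ has a Berezin volume $\boldsymbol\rho$. The modular class $\mathsf{Mod}(M,Q_i)$ is the class of $\mathrm{Div}_{\boldsymbol\rho}Q_i$ in the space of $Q_i$-closed functions modulo $Q_i$-exact functions. For $i=1,2$,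 the class $\mathsf{Mod}(M,Q_i)$ vanishes if and only if there is a Berezin volume $\boldsymbol\rho_i$ with $\mathrm{Div}_{\boldsymbol\rho_i}Q_i=0$. Suppose that both classes vanish, and let $\boldsymbol\rho_1,\boldsymbol\rho_2$ be any Berezin volumes with $\mathrm{Div}_{\boldsymbol\rho_1}Q_1=0$ and $\mathrm{Div}_{\boldsymbol\rho_2}Q_2=0$. Then there is a Berezin volume $\boldsymbol\rho'$ with $\mathrm{Div}_{\boldsymbol\rho'}Q_1=\mathrm{Div}_{\boldsymbol\rho'}Q_2=0$ if and only if there is an even function $\psi\in C^\infty(M)$ with $$\mathrm{Div}_{\boldsymbol\rho_1}Q_2=Q_2(\psi)\qquad\text{and}\qquad Q_1(\psi)=0 .$$ -/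

import Mathlib

open CategoryTheory Opposite TopologicalSpace
open scoped TensorProduct ContDiff

universe u

noncomputable section

namespace SuperGeom

/-- The Koszul sign `(-1)^i` of a parity `i ∈ ℤ/2`. -/
def sgn (i : ZMod 2) : ℝ := if i = 0 then 1 else -1

/-! ### The local model: smooth functions tensored with a Grassmann algebra -/

/-- The space `ℝ^p`. -/
abbrev E (p : ℕ) : Type := EuclideanSpace ℝ (Fin p)

/-- The Grassmann algebra on `q` generators. -/
abbrev Grassmann (q : ℕ) : Type := ExteriorAlgebra ℝ (Fin q → ℝ)

/-- Extension by zero of a real function on an open subset of `ℝ^p`. -/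
def ext {p : ℕ} {W : Opens (E p)} (f : W → ℝ) : E p → ℝ := Function.extend Subtype.val f 0

theorem ext_apply {p : ℕ} {W : Opens (E p)} (f : W → ℝ) (w : W) : ext f w = f w :=
  Subtype.val_injective.extend_apply f 0 w

theorem contDiffOn_ext_congr {p : ℕ} {W : Opens (E p)} {f : W → ℝ} {g : E p → ℝ}
    (hg : ContDiffOn ℝ ∞ g W) (h : ∀ w : W, f w = g w) : ContDiffOn ℝ ∞ (ext f) W :=
  hg.congr fun x hx => (ext_apply f ⟨x, hx⟩).trans (h ⟨x, hx⟩)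

/-- The algebra `C^∞(W)` of smooth real functions on an open subset `W` of `ℝ^p`. -/
def Smooth {p : ℕ} (W : Opens (E p)) : Subalgebra ℝ (W → ℝ) where
  carrier := {f | ContDiffOn ℝ ∞ (ext f) W}
  mul_mem' {f g} hf hg :=
    contDiffOn_ext_congr (ContDiffOn.mul hf hg) fun w => by simp [ext_apply]
  add_mem' {f g} hf hg :=
    contDiffOn_ext_congr (ContDiffOn.add hf hg) fun w => by simp [ext_apply]
  algebraMap_mem' r :=
    contDiffOn_ext_congr (contDiffOn_const (c := r)) fun _ => rfl

/-- Restriction of smooth functions to a smaller open set. -/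
def smoothRes {p : ℕ} {V W : Opens (E p)} (h : V ≤ W) : Smooth W →ₐ[ℝ] Smooth V where
  toFun f := ⟨fun v => f.1 ⟨v, h v.2⟩,
    contDiffOn_ext_congr (ContDiffOn.mono f.2 h) fun v => (ext_apply f.1 ⟨v, h v.2⟩).symm⟩
  map_one' := rfl
  map_mul' _ _ := rfl
  map_zero' := rfl
  map_add' _ _ := rfl
  commutes' _ := rfl

/-- The `i`-th coordinate function on `W`. -/
def smoothCoord {p : ℕ} (W : Opens (E p)) (i : Fin p) : Smooth W :=
  ⟨fun w => w.1 i, contDiffOn_ext_congr (g := fun x => x i)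
    (EuclideanSpace.proj (𝕜 := ℝ) i).contDiff.contDiffOn fun _ => rfl⟩

/-- The partial derivative `∂/∂x^i` on `C^∞(W)`. -/
def smoothPartial {p : ℕ} (W : Opens (E p)) (i : Fin p) : Smooth W →ₗ[ℝ] Smooth W where
  toFun f := ⟨fun w => fderiv ℝ (ext f.1) w (EuclideanSpace.single i 1),
    contDiffOn_ext_congr (g := fun x => fderiv ℝ (ext f.1) x (EuclideanSpace.single i 1))
      ((ContDiffOn.fderiv_of_isOpen (m := ∞) f.2 W.2 (by simp)).clm_apply contDiffOn_const)
      fun _ => rfl⟩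
  map_add' f g := by
    ext w
    have hd : ∀ h : Smooth W, DifferentiableAt ℝ (ext h.1) w := fun h =>
      (ContDiffOn.contDiffAt h.2 (W.2.mem_nhds w.2)).differentiableAt (by simp)
    have he : ext (f + g).1 =ᶠ[nhds (w : E p)] ext f.1 + ext g.1 := by
      filter_upwards [W.2.mem_nhds w.2] with x hx
      exact (ext_apply (f + g).1 ⟨x, hx⟩).trans
        (congrArg₂ (· + ·) (ext_apply f.1 ⟨x, hx⟩) (ext_apply g.1 ⟨x, hx⟩)).symm
    change fderiv ℝ (ext (f + g).1) w _ = fderiv ℝ (ext f.1) w _ + fderiv ℝ (ext g.1) w _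
    rw [he.fderiv_eq, fderiv_add (hd f) (hd g)]
    rfl
  map_smul' r f := by
    ext w
    have hd : DifferentiableAt ℝ (ext f.1) w :=
      (ContDiffOn.contDiffAt f.2 (W.2.mem_nhds w.2)).differentiableAt (by simp)
    have he : ext (r • f).1 =ᶠ[nhds (w : E p)] r • ext f.1 := by
      filter_upwards [W.2.mem_nhds w.2] with x hx
      exact (ext_apply (r • f).1 ⟨x, hx⟩).trans
        (congrArg (r * ·) (ext_apply f.1 ⟨x, hx⟩)).symm
    change fderiv ℝ (ext (r • f).1) w _ = r • fderiv ℝ (ext f.1) w _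
    rw [he.fderiv_eq, fderiv_const_smul hd]
    rfl

/-- The superalgebra `C^∞(W) ⊗ Λ(θ^1, …, θ^q)` of functions on the superdomain `W ⊆ ℝ^{p|q}`. -/
abbrev Model {p : ℕ} (q : ℕ) (W : Opens (E p)) : Type := Smooth W ⊗[ℝ] Grassmann q

/-- Even (`i = 0`) and odd (`i = 1`) functions on a superdomain. -/
def modelGrading {p : ℕ} (q : ℕ) (W : Opens (E p)) (i : ZMod 2) : Submodule ℝ (Model q W) :=
  LinearMap.range (LinearMap.lTensor (Smooth W)
    (CliffordAlgebra.evenOdd (0 : QuadraticForm ℝ (Fin q → ℝ)) i).subtype)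

/-- Restriction of functions on superdomains. -/
def modelRes {p : ℕ} (q : ℕ) {V W : Opens (E p)} (h : V ≤ W) : Model q W →ₐ[ℝ] Model q V :=
  Algebra.TensorProduct.map (smoothRes h) (AlgHom.id ℝ (Grassmann q))

/-- Indices of the coordinates `(x^1, …, x^p, θ^1, …, θ^q)`. -/
abbrev Idx (p q : ℕ) : Type := Fin p ⊕ Fin q

/-- The parity of a coordinate. -/
def Idx.parity {p q : ℕ} : Idx p q → ZMod 2 := Sum.elim (fun _ => 0) (fun _ => 1)

/-- The standard coordinates of a superdomain. -/
def modelCoord {p : ℕ} (q : ℕ) (W : Opens (E p)) : Idx p q → Model q W :=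
  Sum.elim (fun i => smoothCoord W i ⊗ₜ 1)
    (fun j => 1 ⊗ₜ ExteriorAlgebra.ι ℝ (Pi.single j 1 : Fin q → ℝ))

/-- The (left) partial derivatives of a superdomain. The derivative with respect to an odd
coordinate is the left contraction with the dual basis vector. -/
def modelPartial {p : ℕ} (q : ℕ) (W : Opens (E p)) : Idx p q → Model q W →ₗ[ℝ] Model q W :=
  Sum.elim (fun i => LinearMap.rTensor (Grassmann q) (smoothPartial W i))
    (fun j => LinearMap.lTensor (Smooth W)
      (CliffordAlgebra.contractLeft (Q := (0 : QuadraticForm ℝ (Fin q → ℝ)))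
        (LinearMap.proj j : Module.Dual ℝ (Fin q → ℝ))))

/-! ### Supermanifolds -/

/-- A topological space with a sheaf of supercommutative real superalgebras. -/
structure SuperSpace where
  /-- the underlying topological space `|M|` -/
  carrier : TopCat.{u}
  /-- the structure sheaf -/
  sheaf : TopCat.Sheaf (AlgCat.{u} ℝ) carrier
  /-- the even and the odd sections -/
  grading : ∀ U : Opens carrier, ZMod 2 → Submodule ℝ (sheaf.1.obj (op U))
  graded : ∀ U, GradedAlgebra (grading U)
  grading_map : ∀ {U V : Opens carrier} (h : V ≤ U) (i : ZMod 2) (f : sheaf.1.obj (op U)),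
    f ∈ grading U i → sheaf.1.map (homOfLE h).op f ∈ grading V i
  supercomm : ∀ (U : Opens carrier) (i j : ZMod 2) (f g : sheaf.1.obj (op U)),
    f ∈ grading U i → g ∈ grading U j → f * g = sgn (i * j) • (g * f)

/-- The algebra `𝒪_M(U)` of functions over an open set. -/
abbrev SuperSpace.Fn (M : SuperSpace.{u}) (U : Opens M.carrier) : Type u := M.sheaf.1.obj (op U)

/-- Restriction of functions. -/
def SuperSpace.res (M : SuperSpace.{u}) {U V : Opens M.carrier} (h : V ≤ U) :
    M.Fn U →ₐ[ℝ] M.Fn V :=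
  (M.sheaf.1.map (homOfLE h).op).hom

/-- The image, in `ℝ^p`, of an open subset of the domain of a chart. -/
def imageOpens {X : TopCat.{u}} {p : ℕ} (φ : OpenPartialHomeomorph X (E p)) (U : Opens X)
    (h : (U : Set X) ⊆ φ.source) : Opens (E p) :=
  ⟨φ '' U, φ.isOpen_image_of_subset_source U.2 h⟩

/-- A chart: an isomorphism of an open part of the superspace with a superdomain in `ℝ^{p|q}`,
that is, a homeomorphism of the underlying spaces and an isomorphism of the sheaves of
superalgebras. -/
structure Chart (M : SuperSpace.{u}) (p q : ℕ) where
  /-- the domain of the chart -/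
  dom : Opens M.carrier
  /-- the homeomorphism of the domain with an open subset of `ℝ^p` -/
  homeo : OpenPartialHomeomorph M.carrier (E p)
  source_eq : homeo.source = dom
  /-- the isomorphism of the algebras of functions -/
  iso : ∀ (U : Opens M.carrier) (hU : U ≤ dom),
    M.Fn U ≃ₐ[ℝ] Model q (imageOpens homeo U (source_eq ▸ hU))
  iso_res : ∀ (U V : Opens M.carrier) (hU : U ≤ dom) (h : V ≤ U) (f : M.Fn U),
    iso V (h.trans hU) (M.res h f) = modelRes q (Set.image_mono h) (iso U hU f)
  iso_grading : ∀ (U : Opens M.carrier) (hU : U ≤ dom) (i : ZMod 2) (f : M.Fn U),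
    iso U hU f ∈ modelGrading q _ i ↔ f ∈ M.grading U i

namespace Chart

variable {M : SuperSpace.{u}} {p q : ℕ} (c : Chart M p q)

/-- The coordinates `(x^a)` of a chart, as functions over `U`. -/
def coord (U : Opens M.carrier) (hU : U ≤ c.dom) (a : Idx p q) : M.Fn U :=
  (c.iso U hU).symm (modelCoord q _ a)

/-- The partial derivatives `∂/∂x^a` of a chart, acting on functions over `U`. -/
def pd (U : Opens M.carrier) (hU : U ≤ c.dom) (a : Idx p q) : M.Fn U →ₗ[ℝ] M.Fn U :=
  (c.iso U hU).symm.toLinearMap ∘ₗ modelPartial q _ a ∘ₗ (c.iso U hU).toLinearMap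

end Chart

/-- A (real, smooth) supermanifold of dimension `p|q`. -/
structure Supermanifold (p q : ℕ) extends SuperSpace.{u} where
  t2 : T2Space carrier
  secondCountable : SecondCountableTopology carrier
  exists_chart : ∀ x : carrier, ∃ c : Chart toSuperSpace p q, x ∈ c.dom

namespace Supermanifold

/-- The algebra `C^∞(M)` of global functions. -/
abbrev C {p q : ℕ} (M : Supermanifold.{u} p q) : Type u := M.Fn ⊤

end Supermanifold

/-! ### Vector fields -/

/-- A homogeneous vector field of parity `k`: a superderivation of parity `k` of the structure
sheaf. -/
structure VectorField {p q : ℕ} (M : Supermanifold.{u} p q) (k : ZMod 2) where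
  /-- the action on functions over `U` -/
  app : ∀ U : Opens M.carrier, M.Fn U →ₗ[ℝ] M.Fn U
  app_res : ∀ {U V : Opens M.carrier} (h : V ≤ U) (f : M.Fn U),
    app V (M.res h f) = M.res h (app U f)
  app_mem : ∀ (U : Opens M.carrier) (i : ZMod 2) (f : M.Fn U),
    f ∈ M.grading U i → app U f ∈ M.grading U (k + i)
  leibniz : ∀ (U : Opens M.carrier) (i : ZMod 2) (f g : M.Fn U), f ∈ M.grading U i →
    app U (f * g) = app U f * g + sgn (k * i) • (f * app U g)

/-- The action `X(f)` of a vector field on a global function. -/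
def VectorField.act {p q : ℕ} {M : Supermanifold.{u} p q} {k : ZMod 2} (X : VectorField M k) :
    M.C →ₗ[ℝ] M.C :=
  X.app ⊤

/-- The relations of the `N = 2`, `d = 1` supertranslation algebra. -/
structure IsSupertranslation {p q : ℕ} {M : Supermanifold.{u} p q}
    (Q₁ Q₂ : VectorField M 1) (P : VectorField M 0) : Prop where
  sq₁ : ∀ U, Q₁.app U ∘ₗ Q₁.app U = 0
  sq₂ : ∀ U, Q₂.app U ∘ₗ Q₂.app U = 0
  anticomm : ∀ U, Q₁.app U ∘ₗ Q₂.app U + Q₂.app U ∘ₗ Q₁.app U = P.app U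
  comm₁ : ∀ U, P.app U ∘ₗ Q₁.app U - Q₁.app U ∘ₗ P.app U = 0
  comm₂ : ∀ U, P.app U ∘ₗ Q₂.app U - Q₂.app U ∘ₗ P.app U = 0

/-! ### Berezin volumes and divergence -/

/-- The determinant by the Leibniz formula, for a matrix over a possibly noncommutative ring. It
is only applied to matrices of even functions, whose entries commute. -/
def leibnizDet {R : Type*} [Ring R] {n : ℕ} (A : Matrix (Fin n) (Fin n) R) : R :=
  ∑ σ : Equiv.Perm (Fin n), (Equiv.Perm.sign σ : ℤ) • (List.ofFn fun i => A (σ i) i).prod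

/-- The Berezinian `det (A - B D⁻¹ C) · (det D)⁻¹` of a supermatrix with blocks `A, B, C, D`. -/
def berezinian {R : Type*} [Ring R] {p q : ℕ} (J : Matrix (Idx p q) (Idx p q) R) : R :=
  leibnizDet (J.toBlocks₁₁ - J.toBlocks₁₂ * Ring.inverse J.toBlocks₂₂ * J.toBlocks₂₁) *
    Ring.inverse (leibnizDet J.toBlocks₂₂)

/-- The Jacobian matrix `(∂x'^b / ∂x^a)` (row `a`, column `b`) of the coordinates `x'` of the
chart `c'` with respect to the coordinates `x` of the chart `c`. -/
def jacobian {M : SuperSpace.{u}} {p q : ℕ} (c c' : Chart M p q) :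
    Matrix (Idx p q) (Idx p q) (M.Fn (c.dom ⊓ c'.dom)) :=
  Matrix.of fun a b => c.pd _ inf_le_left a (c'.coord _ inf_le_right b)

/-- A Berezin volume: a nowhere vanishing even section `D[x] ρ(x)` of the Berezinian bundle, given
by its coefficients `ρ` in all charts, where `D[x'] = D[x] Ber(∂x'/∂x)`. A function is nowhere
vanishing if and only if it is invertible. -/
structure BerezinVolume {p q : ℕ} (M : Supermanifold.{u} p q) where
  /-- the coefficient with respect to the coordinate volume `D[x]` of a chart -/
  coeff : ∀ c : Chart M.toSuperSpace p q, M.Fn c.dom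
  even : ∀ c, coeff c ∈ M.grading c.dom 0
  isUnit : ∀ c, IsUnit (coeff c)
  compat : ∀ c c' : Chart M.toSuperSpace p q,
    M.res (inf_le_left : c.dom ⊓ c'.dom ≤ c.dom) (coeff c) =
      berezinian (jacobian c c') * M.res inf_le_right (coeff c')

/-- The coefficient, in a chart, of the Lie derivative `L_X ρ`:
`∑ₐ (-1)^{ã(X̃ + 1)} ∂(X^a ρ)/∂x^a` with `X^a = X(x^a)`. -/
def lieCoeff {p q : ℕ} {M : Supermanifold.{u} p q} {k : ZMod 2} (X : VectorField M k)
    (ρ : BerezinVolume M) (c : Chart M.toSuperSpace p q) : M.Fn c.dom :=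
  ∑ a : Idx p q, sgn (a.parity * (k + 1)) •
    c.pd c.dom le_rfl a (X.app c.dom (c.coord c.dom le_rfl a) * ρ.coeff c)

/-- `Div_ρ X = f`, that is, `L_X ρ = ρ f` in every chart. -/
def HasDiv {p q : ℕ} {M : Supermanifold.{u} p q} {k : ZMod 2} (ρ : BerezinVolume M)
    (X : VectorField M k) (f : M.C) : Prop :=
  ∀ c : Chart M.toSuperSpace p q, lieCoeff X ρ c = ρ.coeff c * M.res le_top f

/-! ### Standard cohomology and modular classes -/

/-- The standard cohomology of an odd vector field `Q` (with `Q² = 0`): the `Q`-closed functions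
modulo the `Q`-exact functions. -/
abbrev StdCohomology {p q : ℕ} {M : Supermanifold.{u} p q} (Q : VectorField M 1) : Type u :=
  LinearMap.ker Q.act ⧸ (LinearMap.range Q.act).submoduleOf (LinearMap.ker Q.act)

/-- `κ` is the modular class of `Q`, the class of `Div_ρ Q` in the standard cohomology of `Q`. -/
def IsModularClass {p q : ℕ} {M : Supermanifold.{u} p q} (ρ : BerezinVolume M)
    (Q : VectorField M 1) (κ : StdCohomology Q) : Prop :=
  ∃ f : LinearMap.ker Q.act, HasDiv ρ Q f ∧
    κ = Submodule.Quotient.mk (p := (LinearMap.range Q.act).submoduleOf (LinearMap.ker Q.act)) f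

end SuperGeom

end

/-!
For an invertible even function `h`, the divergence of a vector field `X` satisfies `Div_{hρ} X =
Div_ρ X + X(h)/h` (`HasDiv.smul`), and every Berezin volume is of the form `hρ`, because on
overlaps of charts the coefficients of any two volumes transform with the same Berezinian
(`BerezinVolume.exists_eq_smul`). On a real supermanifold, every even function `f` has an
exponential and every invertible even function `h` has a logarithm `log |h|`, such that `X(exp f)
= X(f) exp f` and `X(log |h|) = X(h)/h` for every vector field `X` (`exists_exp`, `exists_log`). A
change of the Berezin volume therefore changes all divergences by `X(ψ)` with one and the same
even function `ψ`, and every even `ψ` occurs (`BerezinVolume.exists_hasDiv_add`,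
`BerezinVolume.exists_hasDiv_sub`). The theorem follows: the class of `Div_ρ Q` vanishes if and
only if `Div_ρ Q = Q(ψ)` for some even `ψ`, that is, if and only if `exp(-ψ) ρ` has divergence
zero; and a common volume for `Q₁` and `Q₂` is `exp(-ψ) ρ₁` with `Q₁(ψ) = 0` and `Q₂(ψ) = Div_{ρ₁}
Q₂`.

The work is in the exponential and the logarithm. In a chart, they are defined on the body, a
smooth function, and extended by their power series, since the difference of a function and its
body is nilpotent. They are determined by their derivatives and by their values at points
(`Chart.exp_unique`, `Chart.log_unique`), and hence glue, by two facts. Every superderivation `D`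
of the functions over an open part of a chart is `∑ D(xᵃ) ∂/∂xᵃ` (`Chart.superDerivation_eq_sum`);
this rests on Hadamard's lemma and applies to vector fields as well as to the partial derivatives
of another chart. And the value of a function at a point does not depend on the chart
(`Chart.val_eq`).
-/

noncomputable section

namespace SuperGeom

/-! ### Smooth functions -/

section Smooth

variable {p : ℕ} {W : Opens (E p)}

theorem contDiffAt_ext (f : Smooth W) (w : W) : ContDiffAt ℝ ∞ (ext f.1) w :=
  ContDiffOn.contDiffAt f.2 (W.2.mem_nhds w.2)

theorem differentiableAt_ext (f : Smooth W) (w : W) : DifferentiableAt ℝ (ext f.1) w :=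
  (contDiffAt_ext f w).differentiableAt (by simp)

/-- The restriction to `W` of a function that is smooth on `W`. -/
def smoothOf (W : Opens (E p)) (g : E p → ℝ) (hg : ContDiffOn ℝ ∞ g W) : Smooth W :=
  ⟨fun w => g w, contDiffOn_ext_congr hg fun _ => rfl⟩

@[simp] theorem smoothOf_apply (g : E p → ℝ) (hg : ContDiffOn ℝ ∞ g W) (w : W) :
    (smoothOf W g hg).1 w = g w := rfl

theorem smoothPartial_apply (i : Fin p) (f : Smooth W) (w : W) :
    (smoothPartial W i f).1 w = fderiv ℝ (ext f.1) w (EuclideanSpace.single i 1) := rfl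

theorem smoothPartial_eq_of_eqOn (i : Fin p) (f : Smooth W) {g : E p → ℝ}
    (h : ∀ w : W, f.1 w = g w) (w : W) :
    (smoothPartial W i f).1 w = fderiv ℝ g w (EuclideanSpace.single i 1) := by
  rw [smoothPartial_apply]
  congr 1
  apply Filter.EventuallyEq.fderiv_eq
  filter_upwards [W.2.mem_nhds w.2] with x hx
  exact (ext_apply f.1 ⟨x, hx⟩).trans (h ⟨x, hx⟩)

theorem smoothPartial_mul (i : Fin p) (f g : Smooth W) :
    smoothPartial W i (f * g) = smoothPartial W i f * g + f * smoothPartial W i g := by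
  ext w
  rw [smoothPartial_eq_of_eqOn i (f * g) (g := ext f.1 * ext g.1)
    (fun w => by simp [ext_apply])]
  change _ = (smoothPartial W i f).1 w * g.1 w + f.1 w * (smoothPartial W i g).1 w
  rw [fderiv_mul (differentiableAt_ext f w) (differentiableAt_ext g w), smoothPartial_apply,
    smoothPartial_apply]
  simp [ext_apply]
  ring

theorem smoothPartial_one (i : Fin p) : smoothPartial W i 1 = 0 := by
  ext w
  rw [smoothPartial_eq_of_eqOn i 1 (g := fun _ => 1) (fun w => rfl)]
  simp

/-- The composition of a smooth function with a real function that is smooth on its range. -/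
def smoothComp (F : ℝ → ℝ) (b : Smooth W) (hF : ∀ w, ContDiffAt ℝ ∞ F (b.1 w)) : Smooth W :=
  smoothOf W (F ∘ ext b.1) fun x hx => by
    refine ContDiffAt.contDiffWithinAt (ContDiffAt.comp x ?_ (contDiffAt_ext b ⟨x, hx⟩))
    have := hF ⟨x, hx⟩
    rwa [← ext_apply b.1 ⟨x, hx⟩] at this

@[simp] theorem smoothComp_apply (F : ℝ → ℝ) (b : Smooth W)
    (hF : ∀ w, ContDiffAt ℝ ∞ F (b.1 w)) (w : W) : (smoothComp F b hF).1 w = F (b.1 w) :=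
  congrArg F (ext_apply b.1 w)

theorem smoothPartial_comp (i : Fin p) (F : ℝ → ℝ) (b : Smooth W)
    (hF : ∀ w, ContDiffAt ℝ ∞ F (b.1 w)) (w : W) :
    (smoothPartial W i (smoothComp F b hF)).1 w = deriv F (b.1 w) * (smoothPartial W i b).1 w := by
  rw [smoothPartial_eq_of_eqOn i _ (g := F ∘ ext b.1) (fun w => rfl), smoothPartial_apply]
  have h1 : DifferentiableAt ℝ F (ext b.1 w) := by
    rw [ext_apply]; exact (hF w).differentiableAt (by simp)
  rw [fderiv_comp _ h1 (differentiableAt_ext b w), ext_apply]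
  simp [mul_comm]

theorem isUnit_smooth_of_ne_zero (b : Smooth W) (hb : ∀ w, b.1 w ≠ 0) : IsUnit b := by
  refine IsUnit.of_mul_eq_one (smoothComp (·⁻¹) b fun w => contDiffAt_inv ℝ (hb w)) ?_
  ext w
  change b.1 w * (smoothComp _ b _).1 w = 1
  rw [smoothComp_apply, mul_inv_cancel₀ (hb w)]

theorem smoothRes_partial {V : Opens (E p)} (h : V ≤ W) (i : Fin p) (f : Smooth W) :
    smoothPartial V i (smoothRes h f) = smoothRes h (smoothPartial W i f) := by
  ext w
  exact smoothPartial_eq_of_eqOn i _ (fun v => (ext_apply f.1 ⟨v, h v.2⟩).symm) w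

end Smooth

/-! ### Hadamard's lemma -/

section Hadamard

open MeasureTheory

variable {X : Type*} [NormedAddCommGroup X] [NormedSpace ℝ X]

/-- The integral of a smooth function over the unit interval depends smoothly on parameters. The
integral is written as a convolution with the indicator of the interval, evaluated at `0`; a bump
function makes the second factor compactly supported. -/
theorem contDiff_integral_param {h : X → ℝ → ℝ} (hh : ContDiff ℝ ∞ ↿h) :
    ContDiff ℝ ∞ fun x => ∫ t in (0 : ℝ)..1, h x t := by
  let χ : ContDiffBump (0 : ℝ) := ⟨1, 2, one_pos, one_lt_two⟩
  let g : X → ℝ → ℝ := fun x s => χ s * h x (-s)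
  have hg : ContDiff ℝ ∞ ↿g := by
    change ContDiff ℝ ∞ fun z : X × ℝ => χ z.2 * (↿h) (z.1, -z.2)
    exact (χ.contDiff.comp contDiff_snd).mul (hh.comp (contDiff_fst.prodMk contDiff_snd.neg))
  have hf : LocallyIntegrable (Set.indicator (Set.Ioc (0 : ℝ) 1) fun _ => (1 : ℝ)) :=
    ((integrable_indicator_iff measurableSet_Ioc).2 (by simp)).locallyIntegrable
  have key := contDiffOn_convolution_right_with_param_comp (n := ⊤) (𝕜 := ℝ) (μ := volume)
    (ContinuousLinearMap.lsmul ℝ ℝ) (s := Set.univ) (v := fun _ : X => (0 : ℝ))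
    contDiffOn_const (g := g) (k := Metric.closedBall 0 2) isOpen_univ
    (isCompact_closedBall _ _) (fun x s _ hs => by
      have : χ s = 0 := χ.zero_of_le_dist (le_of_lt (by simpa using hs))
      simp [g, this]) hf hg.contDiffOn
  rw [contDiffOn_univ] at key
  convert! key using 2 with x
  rw [convolution_def, intervalIntegral.integral_of_le zero_le_one,
    ← integral_indicator measurableSet_Ioc]
  congr 1
  ext t
  by_cases ht : t ∈ Set.Ioc (0 : ℝ) 1
  · have : χ (-t) = 1 := χ.one_of_mem_closedBall (by
      simpa [abs_le] using ⟨by linarith [ht.1], ht.2⟩)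
    simp [ht, g, this]
  · simp [ht]

/-- Hadamard's lemma on `ℝ^p`. -/
theorem hadamard {p : ℕ} {S : E p → ℝ} (hS : ContDiff ℝ ∞ S) (y : E p) :
    ∃ G : Fin p → E p → ℝ, (∀ i, ContDiff ℝ ∞ (G i)) ∧
      (∀ i, G i y = fderiv ℝ S y (EuclideanSpace.single i 1)) ∧
      ∀ x, S x = S y + ∑ i, (x i - y i) * G i x := by
  have hd : ∀ v : E p, ContDiff ℝ ∞ fun z => fderiv ℝ S z v := fun v =>
    (hS.fderiv_right (m := ∞) (by simp)).clm_apply contDiff_const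
  have hl : ContDiff ℝ ∞ fun z : E p × ℝ => y + z.2 • (z.1 - y) := by fun_prop
  refine ⟨fun i x => ∫ t in (0 : ℝ)..1,
      fderiv ℝ S (y + t • (x - y)) (EuclideanSpace.single i 1), fun i => ?_, fun i => ?_, ?_⟩
  · exact contDiff_integral_param
      (h := fun x t => fderiv ℝ S (y + t • (x - y)) (EuclideanSpace.single i 1))
      ((hd _).comp hl)
  · simp
  · intro x
    have hc : ∀ i, Continuous fun t : ℝ =>
        fderiv ℝ S (y + t • (x - y)) (EuclideanSpace.single i 1) := fun i =>
      (hd _).continuous.comp (by fun_prop)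
    have hder : ∀ t : ℝ, HasDerivAt (fun t : ℝ => S (y + t • (x - y)))
        (∑ i, (x i - y i) * fderiv ℝ S (y + t • (x - y)) (EuclideanSpace.single i 1)) t := by
      intro t
      have h1 : HasDerivAt (fun t : ℝ => y + t • (x - y)) (x - y) t := by
        simpa using ((hasDerivAt_id t).smul_const (x - y)).const_add y
      have h2 := ((hS.differentiable (by simp)) (y + t • (x - y))).hasFDerivAt.comp_hasDerivAt t h1
      refine h2.congr_deriv ?_
      rw [← congrArg (fderiv ℝ S (y + t • (x - y)))
        ((EuclideanSpace.basisFun (Fin p) ℝ).sum_repr (x - y))]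
      simp
    have := intervalIntegral.integral_eq_sub_of_hasDerivAt (a := 0) (b := 1)
      (fun t _ => hder t) (Continuous.intervalIntegrable (by fun_prop) _ _)
    rw [intervalIntegral.integral_finsetSum
      fun i _ => (Continuous.intervalIntegrable (by fun_prop) _ _)] at this
    simp only [intervalIntegral.integral_const_mul] at this
    rw [this]
    simp

/-- Hadamard's lemma on an open set `W`, at the point `y`, up to a term `η² s` with `η y = 0`. Such
a term is annihilated at `y` by every superderivation. -/
theorem hadamard_smooth {p : ℕ} {W : Opens (E p)} (s : Smooth W) (y : W) :
    ∃ (η : Smooth W) (G : Fin p → Smooth W), η.1 y = 0 ∧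
      (∀ i, (G i).1 y = (smoothPartial W i s).1 y) ∧
      s = η * η * s + algebraMap ℝ _ (s.1 y) +
        ∑ i, (smoothCoord W i - algebraMap ℝ _ (y.1 i)) * G i := by
  obtain ⟨r, hr, hball⟩ := Metric.isOpen_iff.1 W.2 y.1 y.2
  let χ : ContDiffBump y.1 := ⟨r / 4, r / 2, by positivity, by linarith⟩
  let S : E p → ℝ := fun x => (1 - (1 - χ x) * (1 - χ x)) * ext s.1 x
  have hSW : ContDiffOn ℝ ∞ S W :=
    ContDiffOn.mul (contDiff_const.sub ((contDiff_const.sub χ.contDiff).mul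
      (contDiff_const.sub χ.contDiff))).contDiffOn s.2
  have hS : ContDiff ℝ ∞ S := by
    rw [contDiff_iff_contDiffAt]
    intro x
    by_cases hx : x ∈ W
    · exact hSW.contDiffAt (W.2.mem_nhds hx)
    · -- off `W` the function vanishes near `x`, which is outside the closed support of `χ`
      have hx' : x ∈ (Metric.closedBall y.1 (r / 2))ᶜ := fun hb =>
        hx (hball (Metric.closedBall_subset_ball (by linarith) hb))
      refine (contDiffAt_const (c := (0 : ℝ))).congr_of_eventuallyEq ?_
      filter_upwards [Metric.isClosed_closedBall.isOpen_compl.mem_nhds hx'] with z hz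
      have : χ z = 0 := χ.zero_of_le_dist (le_of_lt (by simpa using hz))
      simp [S, this]
  obtain ⟨G, hG, hGy, hSG⟩ := hadamard hS y.1
  have hχy : χ =ᶠ[nhds y.1] 1 := χ.eventuallyEq_one
  have hSs : S =ᶠ[nhds y.1] ext s.1 := by
    filter_upwards [hχy] with x hx
    simp [S, hx]
  refine ⟨smoothOf W (fun x => 1 - χ x) (contDiff_const.sub χ.contDiff).contDiffOn,
    fun i => smoothOf W (G i) (hG i).contDiffOn, ?_, fun i => ?_, ?_⟩
  · simp [hχy.self_of_nhds]
  · rw [smoothOf_apply, hGy, hSs.fderiv_eq, smoothPartial_apply]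
  · ext w
    have h1 := hSG w
    rw [hSs.self_of_nhds, ext_apply] at h1
    simp only [S, ext_apply] at h1
    have h2 : s.1 w = (1 - χ w) * (1 - χ w) * s.1 w + s.1 y +
        ∑ i, (w.1 i - y.1 i) * G i w := by linarith
    refine h2.trans ?_
    simp [smoothCoord, smoothOf]

end Hadamard

/-! ### Koszul signs -/

@[simp] theorem sgn_zero : sgn 0 = 1 := if_pos rfl

@[simp] theorem sgn_one : sgn 1 = -1 := if_neg one_ne_zero

theorem sgn_add (i j : ZMod 2) : sgn (i + j) = sgn i * sgn j := by
  have h : ∀ i j : ZMod 2, ((i + j = 0) ↔ (i = 0 ↔ j = 0)) := by decide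
  by_cases hi : i = 0 <;> by_cases hj : j = 0 <;> simp [sgn, h, hi, hj]

/-! ### Grassmann algebras -/

section Grassmann

open CliffordAlgebra

variable {q : ℕ}

/-- The augmentation of the Grassmann algebra, which sends the generators to `0`. -/
abbrev aug (q : ℕ) : Grassmann q →ₐ[ℝ] ℝ := ExteriorAlgebra.algebraMapInv

/-- The left contraction with the `j`-th dual basis vector. -/
abbrev contr (j : Fin q) : Grassmann q →ₗ[ℝ] Grassmann q :=
  contractLeft (Q := (0 : QuadraticForm ℝ (Fin q → ℝ)))
    (LinearMap.proj j : Module.Dual ℝ (Fin q → ℝ))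

theorem contr_ι_mul (j : Fin q) (v : Fin q → ℝ) (y : Grassmann q) :
    contr j (ExteriorAlgebra.ι ℝ v * y) = v j • y - ExteriorAlgebra.ι ℝ v * contr j y :=
  contractLeft_ι_mul _ v y

/-- The contractions are odd superderivations of the Grassmann algebra. -/
theorem contr_mem_and_leibniz (j : Fin q) (i : ZMod 2) (x : Grassmann q)
    (hx : x ∈ evenOdd (0 : QuadraticForm ℝ (Fin q → ℝ)) i) :
    contr j x ∈ evenOdd (0 : QuadraticForm ℝ (Fin q → ℝ)) (1 + i) ∧
      ∀ y, contr j (x * y) = contr j x * y + sgn i • (x * contr j y) := by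
  induction x, hx using evenOdd_induction with
  | range_ι_pow v h =>
    fin_cases i
    · obtain ⟨r, rfl⟩ := Submodule.mem_one.1 (show v ∈ (1 : Submodule ℝ (Grassmann q)) from
        pow_zero (LinearMap.range (ι (0 : QuadraticForm ℝ (Fin q → ℝ)))) ▸ h)
      refine ⟨?_, fun y => ?_⟩
      · simp [contr, contractLeft_algebraMap]
      · change _ = _ + sgn 0 • _
        simp [contr, contractLeft_algebraMap, contractLeft_algebraMap_mul]
    · obtain ⟨w, rfl⟩ : ∃ w, ExteriorAlgebra.ι ℝ w = v := by
        have h' : v ∈ LinearMap.range (ι (0 : QuadraticForm ℝ (Fin q → ℝ))) ^ 1 := h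
        simpa using h'
      have hw : contr j (ExteriorAlgebra.ι ℝ w) = algebraMap ℝ _ (w j) := contractLeft_ι _ _ w
      refine ⟨?_, fun y => ?_⟩
      · rw [hw]
        exact SetLike.algebraMap_mem_graded
          (evenOdd (0 : QuadraticForm ℝ (Fin q → ℝ))) (w j)
      · rw [contr_ι_mul, hw, ← Algebra.smul_def]
        change _ = _ + sgn 1 • _
        simp [sub_eq_add_neg]
  | add x y hx hy ihx ihy =>
    refine ⟨?_, fun z => ?_⟩
    · rw [map_add]; exact add_mem ihx.1 ihy.1
    · rw [add_mul, map_add, map_add, ihx.2, ihy.2]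
      simp only [add_mul, smul_add]
      abel
  | ι_mul_ι_mul m₁ m₂ x hx ih =>
    have hc : ∀ y, contr j (ExteriorAlgebra.ι ℝ m₁ * (ExteriorAlgebra.ι ℝ m₂ * y)) =
        m₁ j • (ExteriorAlgebra.ι ℝ m₂ * y) - m₂ j • (ExteriorAlgebra.ι ℝ m₁ * y) +
          ExteriorAlgebra.ι ℝ m₁ * (ExteriorAlgebra.ι ℝ m₂ * contr j y) := fun y => by
      rw [contr_ι_mul, contr_ι_mul, mul_sub, mul_smul_comm]
      abel
    have hι : ∀ (m : Fin q → ℝ) (k : ZMod 2) (y : Grassmann q),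
        y ∈ evenOdd (0 : QuadraticForm ℝ (Fin q → ℝ)) k →
        ExteriorAlgebra.ι ℝ m * y ∈ evenOdd (0 : QuadraticForm ℝ (Fin q → ℝ)) (1 + k) :=
      fun m k y hy => SetLike.mul_mem_graded (ι_mem_evenOdd_one _ m) hy
    refine ⟨?_, fun y => ?_⟩
    · rw [mul_assoc]
      refine (hc x).symm ▸ ?_
      refine add_mem (sub_mem (Submodule.smul_mem _ _ (hι _ _ _ hx))
        (Submodule.smul_mem _ _ (hι _ _ _ hx))) ?_
      have := hι m₁ _ _ (hι m₂ _ _ ih.1)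
      rwa [show (1 : ZMod 2) + (1 + (1 + i)) = 1 + i by
        rw [← add_assoc 1 1, show (1 : ZMod 2) + 1 = 0 from rfl, zero_add]] at this
    · rw [mul_assoc, mul_assoc, mul_assoc]
      refine (hc (x * y)).trans ?_
      refine Eq.trans ?_ (congrArg₂ (fun a b => a * y + sgn i • b) (hc x).symm rfl)
      rw [ih.2]
      simp only [add_mul, sub_mul, mul_add, smul_mul_assoc, mul_smul_comm, mul_assoc]
      abel

theorem contr_leibniz (j : Fin q) {i : ZMod 2} {x : Grassmann q}
    (hx : x ∈ evenOdd (0 : QuadraticForm ℝ (Fin q → ℝ)) i) (y : Grassmann q) :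
    contr j (x * y) = contr j x * y + sgn i • (x * contr j y) :=
  (contr_mem_and_leibniz j i x hx).2 y

/-- The Euler operator `∑ θ^j ∂/∂θ^j`. -/
def euler (q : ℕ) : Grassmann q →ₗ[ℝ] Grassmann q :=
  ∑ j, LinearMap.mulLeft ℝ (ExteriorAlgebra.ι ℝ (Pi.single j 1 : Fin q → ℝ)) ∘ₗ contr j

theorem euler_apply (y : Grassmann q) :
    euler q y = ∑ j, ExteriorAlgebra.ι ℝ (Pi.single j 1 : Fin q → ℝ) * contr j y := by
  simp [euler]

theorem euler_ι_mul (v : Fin q → ℝ) (y : Grassmann q) :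
    euler q (ExteriorAlgebra.ι ℝ v * y) =
      ExteriorAlgebra.ι ℝ v * y + ExteriorAlgebra.ι ℝ v * euler q y := by
  have hv : v = ∑ j, v j • (Pi.single j 1 : Fin q → ℝ) := by
    ext k; simp [Finset.sum_apply, Pi.single_apply]
  simp only [euler_apply, contr_ι_mul, mul_sub, Finset.sum_sub_distrib]
  have h1 : ∑ j, ExteriorAlgebra.ι ℝ (Pi.single j 1 : Fin q → ℝ) * v j • y =
      ExteriorAlgebra.ι ℝ v * y := by
    conv_rhs => rw [hv, map_sum, Finset.sum_mul]
    simp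
  have h2 : ∀ j : Fin q, ExteriorAlgebra.ι ℝ (Pi.single j 1 : Fin q → ℝ) *
      (ExteriorAlgebra.ι ℝ v * contr j y) =
      -(ExteriorAlgebra.ι ℝ v * (ExteriorAlgebra.ι ℝ (Pi.single j 1 : Fin q → ℝ) *
        contr j y)) := fun j => by
    rw [← mul_assoc, ← mul_assoc, eq_neg_of_add_eq_zero_left
      (ExteriorAlgebra.ι_add_mul_swap (Pi.single j 1 : Fin q → ℝ) v), neg_mul]
  rw [h1, Finset.sum_congr rfl fun j _ => h2 j, Finset.sum_neg_distrib, Finset.mul_sum]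
  abel

theorem euler_of_mem (k : ℕ) {y : Grassmann q} (hy : y ∈ ⋀[ℝ]^k (Fin q → ℝ)) :
    euler q y = (k : ℝ) • y := by
  induction k generalizing y with
  | zero =>
    obtain ⟨r, rfl⟩ := Submodule.mem_one.1 (by simpa using hy)
    rw [euler_apply]
    simp [contr, contractLeft_algebraMap]
  | succ k ih =>
    rw [ExteriorAlgebra.exteriorPower, pow_succ'] at hy
    induction hy using Submodule.mul_induction_on' with
    | mem_mul_mem m hm n hn =>
      obtain ⟨v, rfl⟩ := hm
      rw [euler_ι_mul, ih hn, Nat.cast_succ, add_smul, one_smul, add_comm, mul_smul_comm]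
    | add x hx y hy hx' hy' => rw [map_add, hx', hy', smul_add]

/-- An element of the Grassmann algebra whose odd partial derivatives all vanish is a scalar,
because the Euler operator acts on degree `k` by multiplication with `k`. -/
theorem eq_algebraMap_of_contr_eq_zero {y : Grassmann q} (hy : ∀ j, contr j y = 0) :
    y = algebraMap ℝ _ (aug q y) := by
  have h0 : euler q y = 0 := by rw [euler_apply]; simp [hy]
  let D := fun k : ℕ => ⋀[ℝ]^k (Fin q → ℝ)
  have hcomp : ∀ k, k ≠ 0 → (DirectSum.decompose D y k : Grassmann q) = 0 := by
    intro k hk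
    have hs : ∀ z : Grassmann q,
        (DirectSum.decompose D (euler q z) k : Grassmann q) =
          (k : ℝ) • (DirectSum.decompose D z k : Grassmann q) := by
      intro z
      induction z using DirectSum.Decomposition.inductionOn D with
      | zero => simp
      | @homogeneous i m =>
        rw [euler_of_mem i m.2]
        have hm := Submodule.smul_mem (D i) (i : ℝ) m.2
        by_cases hik : i = k
        · subst hik
          rw [DirectSum.decompose_of_mem_same D hm, DirectSum.decompose_of_mem_same D m.2]
        · rw [DirectSum.decompose_of_mem_ne D hm hik,
            DirectSum.decompose_of_mem_ne D m.2 hik, smul_zero]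
      | add a b ha hb =>
        rw [map_add, DirectSum.decompose_add, DirectSum.decompose_add, DirectSum.add_apply,
          DirectSum.add_apply, Submodule.coe_add, Submodule.coe_add, ha, hb, smul_add]
    have := hs y
    rw [h0, DirectSum.decompose_zero] at this
    exact (smul_eq_zero.1 this.symm).resolve_left (Nat.cast_ne_zero.2 hk)
  have hy0 : y ∈ D 0 := by
    classical
    rw [← DirectSum.sum_support_decompose D y]
    refine sum_mem fun i _ => ?_
    by_cases hi : i = 0
    · subst hi; exact SetLike.coe_mem _
    · rw [hcomp i hi]; exact zero_mem _
  obtain ⟨r, rfl⟩ := Submodule.mem_one.1 (by simpa [D] using hy0)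
  simp

/-- The augmentation ideal of the Grassmann algebra is nilpotent. -/
theorem exists_pow_eq_zero_of_aug (q : ℕ) : ∃ N, ∀ y : Grassmann q, aug q y = 0 → y ^ N = 0 := by
  let R : Submodule ℝ (Grassmann q) := LinearMap.range (ExteriorAlgebra.ι ℝ)
  have hR : R ^ (q + 1) = ⊥ := by
    have h := exteriorPower.finrank_eq ℝ (q + 1) (M := Fin q → ℝ)
    rw [Module.finrank_fin_fun, Nat.choose_succ_self] at h
    exact Submodule.finrank_eq_zero.1 h
  have hTR : ⊤ * R ≤ R * ⊤ := by
    rw [Submodule.mul_le]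
    intro m hm n hn
    clear hm
    induction m using CliffordAlgebra.left_induction with
    | algebraMap r =>
      rw [← Algebra.smul_def]
      have := Submodule.mul_mem_mul (Submodule.smul_mem R r hn)
        (Submodule.mem_top (x := (1 : Grassmann q)))
      rwa [mul_one] at this
    | add x y hx hy => rw [add_mul]; exact add_mem hx hy
    | ι_mul x v _ =>
      rw [mul_assoc]
      exact Submodule.mul_mem_mul ⟨v, rfl⟩ Submodule.mem_top
  have hpow : ∀ k, (R * ⊤) ^ k ≤ R ^ k * ⊤ := by
    intro k
    induction k with
    | zero => simp
    | succ k ih =>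
      calc (R * ⊤) ^ (k + 1) = (R * ⊤) ^ k * (R * ⊤) := pow_succ _ _
        _ ≤ R ^ k * ⊤ * (R * ⊤) := mul_le_mul_left ih _
        _ = R ^ k * (⊤ * R) * ⊤ := by simp only [mul_assoc]
        _ ≤ R ^ k * (R * ⊤) * ⊤ := mul_le_mul_left (mul_le_mul_right hTR _) _
        _ = R ^ (k + 1) * (⊤ * ⊤) := by rw [pow_succ]; simp only [mul_assoc]
        _ ≤ R ^ (k + 1) * ⊤ := mul_le_mul_right le_top _
  have hker : ∀ y : Grassmann q, y - algebraMap ℝ _ (aug q y) ∈ R * ⊤ := by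
    intro y
    induction y using CliffordAlgebra.left_induction with
    | algebraMap r =>
      have : aug q (algebraMap ℝ _ r) = r := AlgHom.commutes _ _
      exact this.symm ▸ (sub_self (algebraMap ℝ (Grassmann q) r)).symm ▸ zero_mem _
    | add x y hx hy =>
      rw [map_add, map_add, add_sub_add_comm]
      exact add_mem hx hy
    | ι_mul x v _ =>
      have : aug q (ι (0 : QuadraticForm ℝ (Fin q → ℝ)) v * x) = 0 := by
        rw [map_mul]
        have : aug q (ι (0 : QuadraticForm ℝ (Fin q → ℝ)) v) = 0 := by
          exact (ExteriorAlgebra.lift_ι_apply ℝ (A := ℝ) 0 (by simp) v)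
        rw [this, zero_mul]
      rw [this, map_zero, sub_zero]
      exact Submodule.mul_mem_mul ⟨v, rfl⟩ Submodule.mem_top
  refine ⟨q + 1, fun y hy => ?_⟩
  have h1 := hker y
  rw [hy, map_zero, sub_zero] at h1
  have h2 := hpow _ (Submodule.pow_mem_pow _ h1 (q + 1))
  rwa [hR, Submodule.bot_mul, Submodule.mem_bot] at h2

end Grassmann

/-! ### Functions on superdomains -/

section Model

open CliffordAlgebra

variable {p q : ℕ} {W : Opens (E p)}

instance : Ring (Model q W) := Algebra.TensorProduct.instRing

instance : AddCommGroup (Model q W) := Ring.toAddCommGroup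

instance : AddGroup (Model q W) := AddCommGroup.toAddGroup

/-- Evaluation of smooth functions at a point. -/
def evalSmooth (w : W) : Smooth W →ₐ[ℝ] ℝ where
  toFun f := f.1 w
  map_one' := rfl
  map_mul' _ _ := rfl
  map_zero' := rfl
  map_add' _ _ := rfl
  commutes' _ := rfl

/-- The value of a function on a superdomain at a point, an element of the Grassmann algebra. -/
def evalModel (w : W) : Model q W →ₐ[ℝ] Grassmann q :=
  (Algebra.TensorProduct.lid ℝ (Grassmann q)).toAlgHom.comp
    (Algebra.TensorProduct.map (evalSmooth w) (AlgHom.id ℝ _))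

@[simp] theorem evalModel_tmul (w : W) (s : Smooth W) (y : Grassmann q) :
    evalModel w (s ⊗ₜ y) = s.1 w • y := by
  simp [evalModel]; rfl

/-- The body of a function on a superdomain: its part without odd coordinates. -/
def modelBody : Model q W →ₐ[ℝ] Smooth W :=
  (Algebra.TensorProduct.rid ℝ ℝ (Smooth W)).toAlgHom.comp
    (Algebra.TensorProduct.map (AlgHom.id ℝ _) (aug q))

@[simp] theorem modelBody_tmul (s : Smooth W) (y : Grassmann q) :
    modelBody (s ⊗ₜ[ℝ] y) = aug q y • s := by
  simp [modelBody]

theorem aug_evalModel (w : W) (x : Model q W) : aug q (evalModel w x) = (modelBody x).1 w := by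
  induction x using TensorProduct.induction_on with
  | zero => simp
  | tmul s y => simp [mul_comm]
  | add x y hx hy => rw [map_add, map_add, map_add, hx, hy]; rfl

theorem model_eq_zero_of_eval {x : Model q W} (hx : ∀ w, evalModel w x = 0) : x = 0 := by
  let b := (Pi.basisFun ℝ (Fin q)).ExteriorAlgebra
  let B := b.baseChange (Smooth W)
  have hB : ∀ i, B i = (1 : Smooth W) ⊗ₜ[ℝ] b i := fun i => b.baseChange_apply _ i
  have key : ∀ w, evalModel w x = ∑ i, (B.repr x i).1 w • b i := by
    intro w
    conv_lhs => rw [← B.sum_repr x]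
    rw [map_sum]
    refine Finset.sum_congr rfl fun i _ => ?_
    rw [hB, TensorProduct.smul_tmul', smul_eq_mul, mul_one, evalModel_tmul]
  have hz : ∀ i, B.repr x i = 0 := by
    intro i
    ext w
    have h := key w
    rw [hx w] at h
    exact (Fintype.linearIndependent_iff.1 b.linearIndependent _ h.symm) i
  rw [← B.sum_repr x]
  simp [hz]

theorem model_ext {x y : Model q W} (h : ∀ w, evalModel w x = evalModel w y) : x = y :=
  sub_eq_zero.1 (model_eq_zero_of_eval fun w => by rw [map_sub, h, sub_self])

theorem exists_pow_eq_zero_of_modelBody (q : ℕ) (W : Opens (E p)) :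
    ∃ N, ∀ x : Model q W, modelBody x = 0 → x ^ N = 0 := by
  obtain ⟨N, hN⟩ := exists_pow_eq_zero_of_aug q
  refine ⟨N, fun x hx => model_eq_zero_of_eval fun w => ?_⟩
  rw [map_pow]
  refine hN _ ?_
  rw [aug_evalModel, hx]
  rfl

theorem tmul_one_comm (s : Smooth W) (x : Model q W) :
    (s ⊗ₜ 1) * x = x * (s ⊗ₜ 1) := by
  refine model_ext fun w => ?_
  simp

/-- A function on a superdomain is invertible where its body does not vanish, because it differs
from its body by a nilpotent function. -/
theorem isUnit_of_modelBody_ne_zero {x : Model q W} (hx : ∀ w, (modelBody x).1 w ≠ 0) :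
    IsUnit x := by
  obtain ⟨N, hN⟩ := exists_pow_eq_zero_of_modelBody q W
  have h1 : IsUnit ((modelBody x ⊗ₜ 1 : Model q W)) :=
    (isUnit_smooth_of_ne_zero _ hx).map
      (Algebra.TensorProduct.includeLeft : Smooth W →ₐ[ℝ] Model q W)
  have h2 : IsNilpotent (x - modelBody x ⊗ₜ 1 : Model q W) := ⟨N, hN _ (by simp)⟩
  have := h2.isUnit_add_left_of_commute h1 (tmul_one_comm (modelBody x) _).symm
  rwa [add_sub_cancel] at this

@[simp] theorem modelPartial_inl_tmul (i : Fin p) (s : Smooth W) (y : Grassmann q) :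
    modelPartial q W (.inl i) (s ⊗ₜ y) = smoothPartial W i s ⊗ₜ y := rfl

@[simp] theorem modelPartial_inr_tmul (j : Fin q) (s : Smooth W) (y : Grassmann q) :
    modelPartial q W (.inr j) (s ⊗ₜ y) = s ⊗ₜ contr j y := rfl

theorem evalModel_modelPartial_inr (j : Fin q) (w : W) (x : Model q W) :
    evalModel w (modelPartial q W (.inr j) x) = contr j (evalModel w x) := by
  induction x using TensorProduct.induction_on with
  | zero => simp
  | tmul s y => simp
  | add x y hx hy => simp only [map_add, hx, hy]

/-- A function on a superdomain with vanishing body and vanishing odd partial derivatives is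
zero. -/
theorem model_eq_zero_of_modelPartial {x : Model q W}
    (hx : ∀ j, modelPartial q W (.inr j) x = 0) (hb : modelBody x = 0) : x = 0 := by
  refine model_eq_zero_of_eval fun w => ?_
  rw [eq_algebraMap_of_contr_eq_zero (y := evalModel w x) fun j => by
    rw [← evalModel_modelPartial_inr, hx, map_zero], aug_evalModel, hb]
  simp

/-! #### Parity -/

theorem tmul_mem_modelGrading (s : Smooth W) {i : ZMod 2} {y : Grassmann q}
    (hy : y ∈ evenOdd (0 : QuadraticForm ℝ (Fin q → ℝ)) i) :
    s ⊗ₜ y ∈ modelGrading q W i :=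
  ⟨s ⊗ₜ ⟨y, hy⟩, rfl⟩

theorem modelGrading_induction {i : ZMod 2} {C : Model q W → Prop} (zero : C 0)
    (tmul : ∀ s y, y ∈ evenOdd (0 : QuadraticForm ℝ (Fin q → ℝ)) i → C (s ⊗ₜ y))
    (add : ∀ x y, C x → C y → C (x + y)) {x : Model q W} (hx : x ∈ modelGrading q W i) : C x := by
  obtain ⟨z, rfl⟩ := hx
  induction z using TensorProduct.induction_on with
  | zero => rw [map_zero]; exact zero
  | tmul s y => exact tmul s y y.2
  | add x y hx hy => rw [map_add]; exact add _ _ hx hy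

theorem tmul_one_mem_modelGrading (s : Smooth W) : s ⊗ₜ 1 ∈ modelGrading q W 0 :=
  tmul_mem_modelGrading s (SetLike.GradedOne.one_mem
    (A := evenOdd (0 : QuadraticForm ℝ (Fin q → ℝ))))

theorem modelCoord_mem (a : Idx p q) : modelCoord q W a ∈ modelGrading q W a.parity := by
  cases a with
  | inl i => exact tmul_one_mem_modelGrading _
  | inr j => exact tmul_mem_modelGrading _ (ι_mem_evenOdd_one _ _)

theorem modelPartial_mem (a : Idx p q) {i : ZMod 2} {x : Model q W}
    (hx : x ∈ modelGrading q W i) : modelPartial q W a x ∈ modelGrading q W (a.parity + i) := by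
  refine modelGrading_induction
    (C := fun x => modelPartial q W a x ∈ modelGrading q W (a.parity + i))
    (by rw [map_zero]; exact zero_mem _) (fun s y hy => ?_)
    (fun x y hx hy => by rw [map_add]; exact add_mem hx hy) hx
  cases a with
  | inl k =>
    rw [show Idx.parity (Sum.inl k : Idx p q) = 0 from rfl, zero_add]
    exact tmul_mem_modelGrading _ hy
  | inr j => exact tmul_mem_modelGrading _ (contr_mem_and_leibniz j i y hy).1

theorem modelPartial_leibniz (a : Idx p q) {i : ZMod 2} {x : Model q W}
    (hx : x ∈ modelGrading q W i) (z : Model q W) :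
    modelPartial q W a (x * z) =
      modelPartial q W a x * z + sgn (a.parity * i) • (x * modelPartial q W a z) := by
  refine modelGrading_induction
    (C := fun x => modelPartial q W a (x * z) =
      modelPartial q W a x * z + sgn (a.parity * i) • (x * modelPartial q W a z))
    (by simp only [zero_mul, map_zero, smul_zero, add_zero])
    (fun s y hy => ?_) (fun x y hx hy => ?_) hx
  · induction z using TensorProduct.induction_on with
    | zero => simp
    | tmul s' y' =>
      cases a with
      | inl k =>
        rw [show Idx.parity (Sum.inl k : Idx p q) = 0 from rfl]
        simp [smoothPartial_mul, TensorProduct.add_tmul]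
      | inr j =>
        rw [show Idx.parity (Sum.inr j : Idx p q) = 1 from rfl]
        simp only [Algebra.TensorProduct.tmul_mul_tmul, modelPartial_inr_tmul, one_mul,
          contr_leibniz j hy, TensorProduct.tmul_add, TensorProduct.tmul_smul]
    | add z z' hz hz' =>
      rw [mul_add, map_add, hz, hz', map_add]
      simp only [mul_add, smul_add]
      abel
  · rw [add_mul, map_add, hx, hy, map_add]
    simp only [add_mul, smul_add]
    abel

theorem modelPartial_coord_inr (a : Idx p q) (j : Fin q) :
    modelPartial q W a (modelCoord q W (.inr j)) = if a = .inr j then 1 else 0 := by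
  cases a with
  | inl i => simp [modelCoord, smoothPartial_one]
  | inr k =>
    have h : contr k (ExteriorAlgebra.ι ℝ (Pi.single j 1 : Fin q → ℝ)) =
        algebraMap ℝ _ ((Pi.single j 1 : Fin q → ℝ) k) := contractLeft_ι _ _ _
    rw [modelCoord, Sum.elim_inr, modelPartial_inr_tmul, h]
    by_cases hjk : k = j
    · subst hjk
      simp [Algebra.TensorProduct.one_def]
    · simp [hjk]

/-! #### Restriction -/

variable {V : Opens (E p)}

@[simp] theorem modelRes_tmul (h : V ≤ W) (s : Smooth W) (y : Grassmann q) :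
    modelRes q h (s ⊗ₜ y) = smoothRes h s ⊗ₜ y := by
  simp [modelRes]

theorem modelBody_modelRes (h : V ≤ W) (x : Model q W) :
    modelBody (modelRes q h x) = smoothRes h (modelBody x) := by
  induction x using TensorProduct.induction_on with
  | zero => simp
  | tmul s y => simp
  | add x y hx hy => simp only [map_add, hx, hy]

theorem modelPartial_modelRes (h : V ≤ W) (a : Idx p q) (x : Model q W) :
    modelPartial q V a (modelRes q h x) = modelRes q h (modelPartial q W a x) := by
  induction x using TensorProduct.induction_on with
  | zero => simp
  | tmul s y => cases a <;> simp [smoothRes_partial]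
  | add x y hx hy => simp only [map_add, hx, hy]

end Model

/-! ### Superderivations of the functions over a chart -/

section SuperDerivation

variable {M : SuperSpace.{u}} {U : Opens M.carrier}

instance (M : SuperSpace.{u}) (U : Opens M.carrier) : GradedAlgebra (M.grading U) := M.graded U

/-- A superderivation of parity `k` of the algebra of functions over `U`. -/
structure IsSuperDerivation (k : ZMod 2) (D : M.Fn U →ₗ[ℝ] M.Fn U) : Prop where
  mem : ∀ (i : ZMod 2) (f : M.Fn U), f ∈ M.grading U i → D f ∈ M.grading U (k + i)
  leibniz : ∀ (i : ZMod 2) (f g : M.Fn U), f ∈ M.grading U i →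
    D (f * g) = D f * g + sgn (k * i) • (f * D g)

theorem SuperSpace.even_comm {f : M.Fn U} (hf : f ∈ M.grading U 0) (g : M.Fn U) :
    f * g = g * f := by
  induction g using DirectSum.Decomposition.inductionOn (M.grading U) with
  | zero => simp
  | @homogeneous i m => simpa using M.supercomm U 0 i f m hf m.2
  | add a b ha hb => rw [mul_add, add_mul, ha, hb]

theorem VectorField.isSuperDerivation {p q : ℕ} {M : Supermanifold.{u} p q} {k : ZMod 2}
    (X : VectorField M k) (U : Opens M.carrier) : IsSuperDerivation k (X.app U) :=
  ⟨X.app_mem U, X.leibniz U⟩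

namespace IsSuperDerivation

variable {k : ZMod 2} {D : M.Fn U →ₗ[ℝ] M.Fn U}

theorem even_mul (hD : IsSuperDerivation k D) {f : M.Fn U} (hf : f ∈ M.grading U 0)
    (g : M.Fn U) : D (f * g) = D f * g + f * D g := by
  simpa using hD.leibniz 0 f g hf

theorem map_one (hD : IsSuperDerivation k D) : D 1 = 0 := by
  simpa using hD.even_mul (SetLike.GradedOne.one_mem (A := M.grading U)) 1

theorem map_algebraMap (hD : IsSuperDerivation k D) (r : ℝ) : D (algebraMap ℝ _ r) = 0 := by
  rw [Algebra.algebraMap_eq_smul_one, map_smul, hD.map_one, smul_zero]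

theorem even_pow_succ (hD : IsSuperDerivation k D) {f : M.Fn U} (hf : f ∈ M.grading U 0)
    (n : ℕ) : D (f ^ (n + 1)) = ((n : ℝ) + 1) • (f ^ n * D f) := by
  induction n with
  | zero => simp
  | succ n ih =>
    rw [pow_succ', hD.even_mul hf, ih, ← SuperSpace.even_comm (f := f ^ (n + 1)) (by
      simpa using SetLike.pow_mem_graded (n + 1) hf), mul_smul_comm, ← mul_assoc, ← pow_succ',
      Nat.cast_succ]
    module

end IsSuperDerivation

end SuperDerivation

namespace Chart

variable {M : SuperSpace.{u}} {p q : ℕ} (c : Chart M p q) {U V : Opens M.carrier}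

/-- The image in `ℝ^p` of an open subset of the domain of a chart. -/
abbrev img (U : Opens M.carrier) (hU : U ≤ c.dom) : Opens (E p) :=
  imageOpens c.homeo U (c.source_eq ▸ hU)

/-- The point of `ℝ^p` that corresponds to a point of the domain of a chart. -/
def pt (U : Opens M.carrier) (hU : U ≤ c.dom) (x : U) : c.img U hU :=
  ⟨c.homeo x, ⟨x, x.2, rfl⟩⟩

theorem exists_pt (hU : U ≤ c.dom) (w : c.img U hU) : ∃ x, c.pt U hU x = w := by
  obtain ⟨w, x, hx, rfl⟩ := w
  exact ⟨⟨x, hx⟩, rfl⟩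

/-- The body of a function, in a chart. -/
def body (U : Opens M.carrier) (hU : U ≤ c.dom) : M.Fn U →ₐ[ℝ] Smooth (c.img U hU) :=
  modelBody.comp (c.iso U hU).toAlgHom

/-- The function over `U` without odd coordinates that is given, in a chart, by a smooth
function. -/
def ofSmooth (U : Opens M.carrier) (hU : U ≤ c.dom) : Smooth (c.img U hU) →ₐ[ℝ] M.Fn U :=
  (c.iso U hU).symm.toAlgHom.comp Algebra.TensorProduct.includeLeft

theorem iso_ofSmooth (hU : U ≤ c.dom) (s : Smooth (c.img U hU)) :
    c.iso U hU (c.ofSmooth U hU s) = s ⊗ₜ 1 :=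
  (c.iso U hU).apply_symm_apply _

@[simp] theorem body_ofSmooth (hU : U ≤ c.dom) (s : Smooth (c.img U hU)) :
    c.body U hU (c.ofSmooth U hU s) = s := by
  change modelBody (c.iso U hU (c.ofSmooth U hU s)) = s
  rw [iso_ofSmooth]
  simp

theorem ofSmooth_mem (hU : U ≤ c.dom) (s : Smooth (c.img U hU)) :
    c.ofSmooth U hU s ∈ M.grading U 0 := by
  rw [← c.iso_grading U hU, iso_ofSmooth]
  exact tmul_one_mem_modelGrading s

theorem coord_mem (hU : U ≤ c.dom) (a : Idx p q) : c.coord U hU a ∈ M.grading U a.parity := by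
  rw [← c.iso_grading U hU, coord, AlgEquiv.apply_symm_apply]
  exact modelCoord_mem a

theorem iso_pd (hU : U ≤ c.dom) (a : Idx p q) (f : M.Fn U) :
    c.iso U hU (c.pd U hU a f) = modelPartial q _ a (c.iso U hU f) :=
  (c.iso U hU).apply_symm_apply _

theorem pd_isSuperDerivation (hU : U ≤ c.dom) (a : Idx p q) :
    IsSuperDerivation a.parity (c.pd U hU a) where
  mem i f hf := by
    rw [← c.iso_grading U hU, iso_pd]
    exact modelPartial_mem a ((c.iso_grading U hU i f).2 hf)
  leibniz i f g hf := by
    apply (c.iso U hU).injective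
    rw [iso_pd, map_mul, modelPartial_leibniz a ((c.iso_grading U hU i f).2 hf), map_add, map_smul,
      map_mul, map_mul, iso_pd, iso_pd]

theorem pd_res (hU : U ≤ c.dom) (h : V ≤ U) (a : Idx p q) (f : M.Fn U) :
    c.pd V (h.trans hU) a (M.res h f) = M.res h (c.pd U hU a f) := by
  apply (c.iso V (h.trans hU)).injective
  rw [iso_pd, c.iso_res U V hU h, c.iso_res U V hU h, iso_pd]
  exact modelPartial_modelRes (Set.image_mono h) a _

theorem body_res (hU : U ≤ c.dom) (h : V ≤ U) (f : M.Fn U) :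
    c.body V (h.trans hU) (M.res h f) = smoothRes (Set.image_mono h) (c.body U hU f) := by
  change modelBody (c.iso V (h.trans hU) (M.res h f)) = _
  rw [c.iso_res U V hU h]
  exact modelBody_modelRes (Set.image_mono h) _

theorem pd_inl_ofSmooth (hU : U ≤ c.dom) (i : Fin p) (s : Smooth (c.img U hU)) :
    c.pd U hU (.inl i) (c.ofSmooth U hU s) = c.ofSmooth U hU (smoothPartial _ i s) := by
  apply (c.iso U hU).injective
  rw [iso_pd, iso_ofSmooth, iso_ofSmooth]
  rfl

theorem pd_inr_ofSmooth (hU : U ≤ c.dom) (j : Fin q) (s : Smooth (c.img U hU)) :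
    c.pd U hU (.inr j) (c.ofSmooth U hU s) = 0 := by
  apply (c.iso U hU).injective
  rw [iso_pd, iso_ofSmooth, modelPartial_inr_tmul, map_zero]
  have : contr j (1 : Grassmann q) = 0 := CliffordAlgebra.contractLeft_one _ _
  rw [this, TensorProduct.tmul_zero]

theorem pd_coord_inr (hU : U ≤ c.dom) (a : Idx p q) (j : Fin q) :
    c.pd U hU a (c.coord U hU (.inr j)) = if a = .inr j then 1 else 0 := by
  apply (c.iso U hU).injective
  rw [iso_pd, coord, AlgEquiv.apply_symm_apply, modelPartial_coord_inr]
  split_ifs <;> simp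

/-- The chain rule on functions without odd coordinates: by Hadamard's lemma, the two sides have
the same value at every point. -/
theorem superDerivation_ofSmooth (hU : U ≤ c.dom) {k : ZMod 2} {D : M.Fn U →ₗ[ℝ] M.Fn U}
    (hD : IsSuperDerivation k D) (s : Smooth (c.img U hU)) :
    D (c.ofSmooth U hU s) =
      ∑ i, D (c.coord U hU (.inl i)) * c.ofSmooth U hU (smoothPartial _ i s) := by
  apply (c.iso U hU).injective
  refine model_ext fun y => ?_
  let ev : M.Fn U →ₐ[ℝ] Grassmann q := (evalModel y).comp (c.iso U hU).toAlgHom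
  let σ := c.ofSmooth U hU
  change ev _ = ev _
  have hev : ∀ t, ev (σ t) = algebraMap ℝ _ (t.1 y) := fun t => by
    change evalModel y (c.iso U hU (c.ofSmooth U hU t)) = _
    rw [iso_ofSmooth, evalModel_tmul, Algebra.algebraMap_eq_smul_one]
  have heven := c.ofSmooth_mem hU
  obtain ⟨η, G, hη, hG, hs⟩ := hadamard_smooth s y
  have hx : ∀ i, σ (smoothCoord _ i) = c.coord U hU (.inl i) := fun i => rfl
  have h1 : ev (D (σ (η * η * s))) = 0 := by
    rw [mul_assoc, map_mul, hD.even_mul (heven η), map_mul, map_add, map_mul, map_mul, map_mul,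
      hev η, hη]
    simp
  have h2 : ∀ i, ev (D (σ ((smoothCoord _ i - algebraMap ℝ _ (y.1 i)) * G i))) =
      ev (D (c.coord U hU (.inl i))) * algebraMap ℝ _ ((smoothPartial _ i s).1 y) := by
    intro i
    rw [map_mul, hD.even_mul (heven _), map_add, map_mul ev, map_mul ev, hev (G i), hG,
      hev (smoothCoord _ i - algebraMap ℝ _ (y.1 i)), map_sub, map_sub, hx, AlgHom.commutes,
      hD.map_algebraMap, sub_zero]
    have : (smoothCoord (c.img U hU) i - algebraMap ℝ _ (y.1 i)).1 y = 0 := sub_self (y.1 i)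
    rw [this]
    simp
  have h3 : D (σ s) = D (σ (η * η * s)) +
      ∑ i, D (σ ((smoothCoord _ i - algebraMap ℝ _ (y.1 i)) * G i)) := by
    have h4 : σ s = σ (η * η * s) + algebraMap ℝ _ (s.1 y) +
        ∑ i, σ ((smoothCoord _ i - algebraMap ℝ _ (y.1 i)) * G i) := by
      conv_lhs => rw [hs]
      rw [map_add, map_add, AlgHom.commutes, map_sum]
    rw [h4, map_add, map_add, hD.map_algebraMap, add_zero, map_sum]
  rw [h3, map_add, h1, zero_add, map_sum, map_sum]
  refine Finset.sum_congr rfl fun i _ => ?_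
  rw [h2, map_mul, hev]

/-- Superderivations that agree on functions without odd coordinates and on the odd coordinates
are equal. -/
theorem superDerivation_ext (hU : U ≤ c.dom) {k : ZMod 2} {D D' : M.Fn U →ₗ[ℝ] M.Fn U}
    (hD : IsSuperDerivation k D) (hD' : IsSuperDerivation k D')
    (hs : ∀ s, D (c.ofSmooth U hU s) = D' (c.ofSmooth U hU s))
    (hθ : ∀ j, D (c.coord U hU (.inr j)) = D' (c.coord U hU (.inr j))) : D = D' := by
  let τ : Grassmann q →ₐ[ℝ] M.Fn U :=
    (c.iso U hU).symm.toAlgHom.comp Algebra.TensorProduct.includeRight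
  have hι : ∀ v : Fin q → ℝ,
      τ (ExteriorAlgebra.ι ℝ v) = ∑ j, v j • c.coord U hU (.inr j) := by
    intro v
    have hv : v = ∑ j, v j • (Pi.single j 1 : Fin q → ℝ) := by
      ext k; simp [Finset.sum_apply, Pi.single_apply]
    conv_lhs => rw [hv]
    simp only [map_sum, map_smul]
    rfl
  have hτ : ∀ y, D (τ y) = D' (τ y) := by
    intro y
    induction y using CliffordAlgebra.left_induction with
    | algebraMap r =>
      have : τ (algebraMap ℝ _ r) = algebraMap ℝ _ r := AlgHom.commutes _ _
      exact this.symm ▸ (hD.map_algebraMap r).trans (hD'.map_algebraMap r).symm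
    | add x y hx hy => rw [map_add, map_add, map_add, hx, hy]
    | ι_mul x v hx =>
      have hv : τ (ExteriorAlgebra.ι ℝ v) ∈ M.grading U 1 := by
        rw [hι]
        exact sum_mem fun j _ => Submodule.smul_mem _ _ (c.coord_mem hU (.inr j))
      have hv' : D (τ (ExteriorAlgebra.ι ℝ v)) = D' (τ (ExteriorAlgebra.ι ℝ v)) := by
        simp only [hι, map_sum, map_smul, hθ]
      change D (τ (ExteriorAlgebra.ι ℝ v * x)) = D' (τ (ExteriorAlgebra.ι ℝ v * x))
      rw [map_mul, hD.leibniz 1 _ _ hv, hD'.leibniz 1 _ _ hv, hv', hx]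
  ext f
  obtain ⟨x, rfl⟩ := (c.iso U hU).symm.surjective f
  induction x using TensorProduct.induction_on with
  | zero => simp
  | tmul s y =>
    have : (c.iso U hU).symm (s ⊗ₜ y) = c.ofSmooth U hU s * τ y := by
      change _ = (c.iso U hU).symm (s ⊗ₜ 1) * (c.iso U hU).symm (1 ⊗ₜ y)
      rw [← map_mul, Algebra.TensorProduct.tmul_mul_tmul, mul_one, one_mul]
    rw [this, hD.even_mul (c.ofSmooth_mem hU s), hD'.even_mul (c.ofSmooth_mem hU s), hs, hτ]
  | add x y hx hy => rw [map_add, map_add, map_add, hx, hy]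

/-- Every superderivation is a combination of partial derivatives. -/
theorem superDerivation_eq_sum (hU : U ≤ c.dom) {k : ZMod 2} {D : M.Fn U →ₗ[ℝ] M.Fn U}
    (hD : IsSuperDerivation k D) (f : M.Fn U) :
    D f = ∑ a, D (c.coord U hU a) * c.pd U hU a f := by
  have h2 : ∀ a : ZMod 2, a + a = 0 := by decide
  let R : M.Fn U →ₗ[ℝ] M.Fn U :=
    ∑ a, LinearMap.mulLeft ℝ (D (c.coord U hU a)) ∘ₗ c.pd U hU a
  have hRf : ∀ f, R f = ∑ a, D (c.coord U hU a) * c.pd U hU a f := fun f => by simp [R]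
  have hX : ∀ a, D (c.coord U hU a) ∈ M.grading U (k + a.parity) := fun a =>
    hD.mem _ _ (c.coord_mem hU a)
  have hR : IsSuperDerivation k R := by
    refine ⟨fun i f hf => ?_, fun i f g hf => ?_⟩
    · rw [hRf]
      refine sum_mem fun a _ => ?_
      have := SetLike.mul_mem_graded (hX a) ((c.pd_isSuperDerivation hU a).mem i f hf)
      rwa [show k + a.parity + (a.parity + i) = k + i by
        rw [add_assoc, ← add_assoc a.parity, h2, zero_add]] at this
    · rw [hRf, hRf, hRf, Finset.sum_mul, Finset.mul_sum, Finset.smul_sum, ← Finset.sum_add_distrib]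
      refine Finset.sum_congr rfl fun a _ => ?_
      rw [(c.pd_isSuperDerivation hU a).leibniz i f g hf, mul_add, mul_smul_comm, ← mul_assoc,
        ← mul_assoc, M.supercomm U _ i _ f (hX a) hf, smul_mul_assoc, smul_smul, ← sgn_add,
        mul_assoc f]
      congr 2
      rw [add_mul, add_comm (k * i), ← add_assoc, h2, zero_add]
  rw [← hRf]
  refine LinearMap.congr_fun (c.superDerivation_ext hU hD hR (fun s => ?_) fun j => ?_) f
  · rw [hRf, c.superDerivation_ofSmooth hU hD, Fintype.sum_sum_type]
    simp [pd_inl_ofSmooth, pd_inr_ofSmooth]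
  · simp [hRf, pd_coord_inr]

end Chart

/-! ### Values of functions at points -/

namespace Chart

variable {M : SuperSpace.{u}} {p q : ℕ} (c c' : Chart M p q) {U V : Opens M.carrier}

/-- The value at a point of the body of a function, in a chart. -/
def val (U : Opens M.carrier) (hU : U ≤ c.dom) (x : U) : M.Fn U →ₐ[ℝ] ℝ :=
  (evalSmooth (c.pt U hU x)).comp (c.body U hU)

theorem val_apply (hU : U ≤ c.dom) (x : U) (f : M.Fn U) :
    c.val U hU x f = (c.body U hU f).1 (c.pt U hU x) := rfl

theorem val_res (hU : U ≤ c.dom) (h : V ≤ U) (x : V) (f : M.Fn U) :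
    c.val V (h.trans hU) x (M.res h f) = c.val U hU ⟨x, h x.2⟩ f := by
  rw [val_apply, body_res]
  rfl

theorem val_ofSmooth (hU : U ≤ c.dom) (x : U) (s : Smooth (c.img U hU)) :
    c.val U hU x (c.ofSmooth U hU s) = s.1 (c.pt U hU x) := by
  rw [val_apply, body_ofSmooth]

theorem isUnit_of_val_ne_zero (hU : U ≤ c.dom) {f : M.Fn U} (hf : ∀ x, c.val U hU x f ≠ 0) :
    IsUnit f := by
  have h : IsUnit (c.iso U hU f) := by
    refine isUnit_of_modelBody_ne_zero fun w => ?_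
    obtain ⟨x, rfl⟩ := c.exists_pt hU w
    exact hf x
  simpa using h.map (c.iso U hU).symm

theorem val_ne_zero_of_isUnit (hU : U ≤ c.dom) {f : M.Fn U} (hf : IsUnit f) (x : U) :
    c.val U hU x f ≠ 0 :=
  (hf.map (c.val U hU x)).ne_zero

theorem exists_opens_val_ne_zero (hU : U ≤ c.dom) (f : M.Fn U) (x : U)
    (hx : c.val U hU x f ≠ 0) :
    ∃ (V : Opens M.carrier) (h : V ≤ U), x.1 ∈ V ∧ ∀ z : V, c.val U hU ⟨z, h z.2⟩ f ≠ 0 := by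
  let b := c.body U hU f
  have hext : ∀ z : U, ext b.1 (c.homeo z) = c.val U hU z f := fun z => ext_apply b.1 (c.pt U hU z)
  have hc : ContinuousOn (fun z => ext b.1 (c.homeo z)) U :=
    ContinuousOn.comp (ContDiffOn.continuousOn b.2)
      (c.homeo.continuousOn.mono (by rw [c.source_eq]; exact hU)) fun z hz => ⟨z, hz, rfl⟩
  refine ⟨⟨_, hc.isOpen_inter_preimage U.2 (isOpen_compl_singleton (x := (0 : ℝ)))⟩,
    fun z hz => hz.1, ⟨x.2, ?_⟩, fun z => ?_⟩
  · simpa [hext x] using hx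
  · have := z.2.2
    simpa [hext ⟨z, z.2.1⟩] using this

/-- The value at a point does not depend on the chart: the value of `f` at `x` is the only real
number `r` such that `f - r` is not invertible in any neighbourhood of `x`. -/
theorem val_eq (hU : U ≤ c.dom) (hU' : U ≤ c'.dom) (x : U) (f : M.Fn U) :
    c.val U hU x f = c'.val U hU' x f := by
  by_contra hne
  let g := f - algebraMap ℝ _ (c.val U hU x f)
  have h0 : c.val U hU x g = 0 := by simp [g]
  have h0' : c'.val U hU' x g ≠ 0 := by
    simpa [g, sub_eq_zero] using Ne.symm hne
  obtain ⟨V, h, hx, hV⟩ := c'.exists_opens_val_ne_zero hU' g x h0'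
  have hu : IsUnit (M.res h g) := by
    refine c'.isUnit_of_val_ne_zero (h.trans hU') fun z => ?_
    rw [val_res]
    exact hV z
  refine c.val_ne_zero_of_isUnit (h.trans hU) hu ⟨x, hx⟩ ?_
  rw [val_res]
  exact h0

/-- A function is determined by its partial derivatives and its values at points. -/
theorem eq_zero_of_pd_of_val (hU : U ≤ c.dom) {f : M.Fn U} (hpd : ∀ a, c.pd U hU a f = 0)
    (hval : ∀ x, c.val U hU x f = 0) : f = 0 := by
  apply (c.iso U hU).injective
  rw [map_zero]
  refine model_eq_zero_of_modelPartial (fun j => ?_) ?_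
  · rw [← iso_pd, hpd, map_zero]
  · ext w
    obtain ⟨x, rfl⟩ := c.exists_pt hU w
    exact hval x

end Chart

theorem SuperSpace.even_of_mul_eq_one {M : SuperSpace.{u}} {U : Opens M.carrier} {f g : M.Fn U}
    (hf : f ∈ M.grading U 0) (h : f * g = 1) : g ∈ M.grading U 0 := by
  have h1 : f * (DirectSum.decompose (M.grading U) g 0 : M.Fn U) = 1 := by
    rw [← DirectSum.coe_decompose_mul_add_of_left_mem (M.grading U) hf, h, add_zero]
    exact DirectSum.decompose_of_mem_same _ (SetLike.GradedOne.one_mem (A := M.grading U))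
  have h2 : g = DirectSum.decompose (M.grading U) g 0 :=
    calc g = (f * (DirectSum.decompose (M.grading U) g 0 : M.Fn U)) * g := by rw [h1, one_mul]
      _ = (DirectSum.decompose (M.grading U) g 0 : M.Fn U) * (f * g) := by
        rw [SuperSpace.even_comm hf, mul_assoc]
      _ = _ := by rw [h, mul_one]
  rw [h2]
  exact SetLike.coe_mem _

/-! ### Exponentials and logarithms of even functions over a chart -/

namespace Chart

variable {M : SuperSpace.{u}} {p q : ℕ} (c : Chart M p q) {U V : Opens M.carrier}

theorem exists_pow_eq_zero_of_body (hU : U ≤ c.dom) :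
    ∃ N, ∀ f : M.Fn U, c.body U hU f = 0 → f ^ N = 0 := by
  obtain ⟨N, hN⟩ := exists_pow_eq_zero_of_modelBody q (c.img U hU)
  refine ⟨N, fun f hf => (c.iso U hU).injective ?_⟩
  rw [map_pow, map_zero]
  exact hN _ hf

theorem pd_ofSmooth_comp (hU : U ≤ c.dom) (a : Idx p q) (F : ℝ → ℝ)
    (b s t : Smooth (c.img U hU)) (hF : ∀ w, ContDiffAt ℝ ∞ F (b.1 w))
    (h : ∀ w, deriv F (b.1 w) * s.1 w = t.1 w) :
    c.pd U hU a (c.ofSmooth U hU (smoothComp F b hF)) * c.ofSmooth U hU s =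
      c.pd U hU a (c.ofSmooth U hU b) * c.ofSmooth U hU t := by
  cases a with
  | inl i =>
    rw [pd_inl_ofSmooth, pd_inl_ofSmooth, ← map_mul, ← map_mul]
    congr 1
    ext w
    change (smoothPartial _ i _).1 w * s.1 w = (smoothPartial _ i b).1 w * t.1 w
    rw [smoothPartial_comp, ← h]
    ring
  | inr j => rw [pd_inr_ofSmooth, pd_inr_ofSmooth, zero_mul, zero_mul]

/-- Existence of the exponential: with `f = b + n`, where `b` is the body and `n` is nilpotent, it
is `exp b * ∑ n ^ k / k!`. -/
theorem exists_exp (hU : U ≤ c.dom) {f : M.Fn U} (hf : f ∈ M.grading U 0) :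
    ∃ e ∈ M.grading U 0, (∀ a, c.pd U hU a e = c.pd U hU a f * e) ∧
      ∀ x, c.val U hU x e = Real.exp (c.val U hU x f) := by
  obtain ⟨N, hN⟩ := c.exists_pow_eq_zero_of_body hU
  let b := c.body U hU f
  let σ := c.ofSmooth U hU
  have hσ : ∀ s, σ s ∈ M.grading U 0 := c.ofSmooth_mem hU
  let n := f - σ b
  have hn : n ∈ M.grading U 0 := sub_mem hf (hσ b)
  have hn0 : c.body U hU n = 0 := by simp [n, σ, b]
  let eb := smoothComp Real.exp b fun w => Real.contDiff_exp.contDiffAt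
  let S := ∑ k ∈ Finset.range (N + 1), ((k.factorial : ℝ)⁻¹) • n ^ k
  have hpow : ∀ k, n ^ k ∈ M.grading U 0 := fun k => by
    simpa using SetLike.pow_mem_graded k hn
  have hS : S ∈ M.grading U 0 := sum_mem fun k _ => Submodule.smul_mem _ _ (hpow k)
  have he : σ eb * S ∈ M.grading U 0 := by
    simpa using SetLike.mul_mem_graded (hσ eb) hS
  refine ⟨σ eb * S, he, fun a => ?_, fun x => ?_⟩
  · have hD := c.pd_isSuperDerivation hU a
    have h1 : c.pd U hU a (σ eb) = c.pd U hU a (σ b) * σ eb := by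
      have := c.pd_ofSmooth_comp hU a Real.exp b 1 eb
        (fun w => Real.contDiff_exp.contDiffAt) (fun w => by
          rw [smoothComp_apply, Real.deriv_exp]; exact mul_one _)
      rwa [map_one, mul_one] at this
    have h2 : c.pd U hU a S = S * c.pd U hU a n := by
      have hlast : S = ∑ k ∈ Finset.range N, ((k.factorial : ℝ)⁻¹) • n ^ k := by
        simp only [S]
        rw [Finset.sum_range_succ, hN n hn0, smul_zero, add_zero]
      conv_rhs => rw [hlast]
      simp only [S]
      rw [map_sum, Finset.sum_range_succ', pow_zero, map_smul, hD.map_one, smul_zero, add_zero,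
        Finset.sum_mul]
      refine Finset.sum_congr rfl fun k _ => ?_
      rw [map_smul, hD.even_pow_succ hn, smul_smul, smul_mul_assoc, Nat.factorial_succ]
      congr 1
      push_cast
      have : (k : ℝ) + 1 ≠ 0 := by positivity
      field_simp
    have h3 : c.pd U hU a f = c.pd U hU a (σ b) + c.pd U hU a n := by
      rw [← map_add]; simp [n]
    rw [hD.even_mul (hσ eb), h1, h2, h3, ← mul_assoc, SuperSpace.even_comm he, add_mul, mul_assoc]
  · have h0 : c.val U hU x n = 0 := by rw [val_apply, hn0]; rfl
    rw [map_mul, c.val_ofSmooth, smoothComp_apply, map_sum, Finset.sum_range_succ']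
    simp only [map_smul, map_pow, h0]
    simp [val_apply, b]

/-- Existence of the logarithm: with `h = b * (1 + m)`, where `b` is the body and `m` is nilpotent,
it is `log |b| + ∑ (-1) ^ k m ^ (k + 1) / (k + 1)`. -/
theorem exists_log (hU : U ≤ c.dom) {h : M.Fn U} (hh : h ∈ M.grading U 0) (hu : IsUnit h) :
    ∃ ψ ∈ M.grading U 0, (∀ a, c.pd U hU a ψ * h = c.pd U hU a h) ∧
      ∀ x, c.val U hU x ψ = Real.log (c.val U hU x h) := by
  obtain ⟨N, hN⟩ := c.exists_pow_eq_zero_of_body hU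
  let b := c.body U hU h
  have hbu : IsUnit b := hu.map (c.body U hU)
  obtain ⟨β, hβ⟩ := hbu.exists_right_inv
  have hb : ∀ w, b.1 w ≠ 0 := fun w => (hbu.map (evalSmooth w)).ne_zero
  let σ := c.ofSmooth U hU
  have hσ : ∀ s, σ s ∈ M.grading U 0 := c.ofSmooth_mem hU
  let m := σ β * (h - σ b)
  have hm : m ∈ M.grading U 0 := by
    simpa using SetLike.mul_mem_graded (hσ β) (sub_mem hh (hσ b))
  have hm0 : c.body U hU m = 0 := by simp [m, σ, b]
  have hσβ : σ b * σ β = 1 := by rw [← map_mul, hβ, map_one]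
  have hbm : h = σ b * (1 + m) := by
    simp only [m]
    rw [mul_add, ← mul_assoc, hσβ]
    simp
  let lb := smoothComp Real.log b fun w => Real.contDiffAt_log.2 (hb w)
  let S := ∑ k ∈ Finset.range N, ((-1 : ℝ) ^ k / ((k : ℝ) + 1)) • m ^ (k + 1)
  have hpow : ∀ k, m ^ k ∈ M.grading U 0 := fun k => by
    simpa using SetLike.pow_mem_graded k hm
  have hm1 : 1 + m ∈ M.grading U 0 := by
    simpa using add_mem (hpow 0) (hpow 1)
  have hS : S ∈ M.grading U 0 := sum_mem fun k _ => Submodule.smul_mem _ _ (hpow _)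
  refine ⟨σ lb + S, add_mem (hσ lb) hS, fun a => ?_, fun x => ?_⟩
  · have hD := c.pd_isSuperDerivation hU a
    have h1 : c.pd U hU a (σ lb) * σ b = c.pd U hU a (σ b) := by
      have := c.pd_ofSmooth_comp hU a Real.log b b 1
        (fun w => Real.contDiffAt_log.2 (hb w)) (fun w => by
          rw [Real.deriv_log, inv_mul_cancel₀ (hb w)]; rfl)
      rwa [map_one, mul_one] at this
    have h2 : c.pd U hU a S = (∑ k ∈ Finset.range N, (-m) ^ k) * c.pd U hU a m := by
      simp only [S]
      rw [map_sum, Finset.sum_mul]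
      refine Finset.sum_congr rfl fun k _ => ?_
      have : (k : ℝ) + 1 ≠ 0 := by positivity
      rw [map_smul, hD.even_pow_succ hm, smul_smul, div_mul_cancel₀ _ this, neg_pow m,
        ← smul_mul_assoc, Algebra.smul_def, map_pow, map_neg, map_one]
    have h3 : (1 + m) * ∑ k ∈ Finset.range N, (-m) ^ k = 1 := by
      have := mul_neg_geom_sum (-m) N
      rwa [sub_neg_eq_add, neg_pow m N, hN m hm0, mul_zero, sub_zero] at this
    have h4 : c.pd U hU a S * (1 + m) = c.pd U hU a m := by
      rw [h2, ← SuperSpace.even_comm hm1, ← mul_assoc, h3, one_mul]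
    have h5 : c.pd U hU a h = c.pd U hU a (σ b) * (1 + m) + σ b * c.pd U hU a m := by
      conv_lhs => rw [hbm]
      rw [hD.even_mul (hσ b), map_add, hD.map_one, zero_add]
    rw [h5, map_add, add_mul]
    congr 1
    · conv_lhs => rw [hbm]
      rw [← mul_assoc, h1]
    · conv_lhs => rw [hbm]
      rw [SuperSpace.even_comm (hσ b) (1 + m), ← mul_assoc, h4, SuperSpace.even_comm (hσ b)]
  · have h0 : c.val U hU x m = 0 := by rw [val_apply, hm0]; rfl
    rw [map_add, c.val_ofSmooth, smoothComp_apply, map_sum]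
    simp only [map_smul, map_pow, h0]
    simp [val_apply, b]

theorem log_unique (hU : U ≤ c.dom) {h ψ ψ' : M.Fn U} (hu : IsUnit h)
    (hψ : ∀ a, c.pd U hU a ψ * h = c.pd U hU a h)
    (hψ' : ∀ a, c.pd U hU a ψ' * h = c.pd U hU a h)
    (hval : ∀ x, c.val U hU x ψ = c.val U hU x ψ') : ψ = ψ' := by
  refine sub_eq_zero.1 (c.eq_zero_of_pd_of_val hU (fun a => ?_) fun x => ?_)
  · rw [map_sub, sub_eq_zero]
    exact hu.mul_right_cancel ((hψ a).trans (hψ' a).symm)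
  · rw [map_sub, hval, sub_self]

theorem exp_unique (hU : U ≤ c.dom) {f e e' : M.Fn U} (he : e ∈ M.grading U 0)
    (he' : e' ∈ M.grading U 0) (hu : IsUnit e')
    (hpd : ∀ a, c.pd U hU a e = c.pd U hU a f * e)
    (hpd' : ∀ a, c.pd U hU a e' = c.pd U hU a f * e')
    (hval : ∀ x, c.val U hU x e = c.val U hU x e') : e = e' := by
  obtain ⟨g, hg⟩ := hu.exists_right_inv
  have hg0 := SuperSpace.even_of_mul_eq_one he' hg
  -- the quotient `v` of the two exponentials has vanishing derivatives
  let v := g * e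
  have hv0 : v ∈ M.grading U 0 := by simpa using SetLike.mul_mem_graded hg0 he
  have hv : e' * v = e := by simp only [v]; rw [← mul_assoc, hg, one_mul]
  have h1 : v - 1 = 0 := by
    refine c.eq_zero_of_pd_of_val hU (fun a => ?_) fun x => ?_
    · have hD := c.pd_isSuperDerivation hU a
      rw [map_sub, hD.map_one, sub_zero]
      have h2 := hpd a
      rw [← hv, hD.even_mul he', hpd', mul_assoc, add_eq_left] at h2
      exact (hu.mul_right_eq_zero).1 h2
    · have h2 := hval x
      rw [← hv, map_mul] at h2
      rw [map_sub, map_one, sub_eq_zero]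
      exact (mul_eq_left₀ (c.val_ne_zero_of_isUnit hU hu x)).1 h2
  rw [← hv, sub_eq_zero.1 h1, mul_one]

end Chart

/-! ### Locality and gluing -/

section Gluing

variable {p q : ℕ} {M : Supermanifold.{u} p q}

theorem SuperSpace.res_res {M : SuperSpace.{u}} {U V W : Opens M.carrier} (h : V ≤ U) (h' : W ≤ V)
    (f : M.Fn U) : M.res h' (M.res h f) = M.res (h'.trans h) f := by
  change M.sheaf.1.map _ (M.sheaf.1.map _ f) = M.sheaf.1.map _ f
  rw [← ConcreteCategory.comp_apply, ← M.sheaf.1.map_comp]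
  rfl

theorem SuperSpace.res_mem {M : SuperSpace.{u}} {U V : Opens M.carrier} (h : V ≤ U) (i : ZMod 2)
    (f : M.Fn U) (hf : f ∈ M.grading U i) : M.res h f ∈ M.grading V i :=
  M.grading_map h i f hf

theorem Supermanifold.le_iSup_dom (M : Supermanifold.{u} p q) :
    ⊤ ≤ ⨆ c : Chart M.toSuperSpace p q, c.dom := by
  intro x _
  obtain ⟨c, hc⟩ := M.exists_chart x
  exact Opens.mem_iSup.2 ⟨c, hc⟩

theorem Supermanifold.eq_of_res_eq {f g : M.C}
    (h : ∀ c : Chart M.toSuperSpace p q, M.res (le_top : c.dom ≤ ⊤) f = M.res le_top g) : f = g :=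
  M.sheaf.eq_of_locally_eq' (fun c : Chart M.toSuperSpace p q => c.dom) ⊤
    (fun _ => homOfLE le_top) M.le_iSup_dom f g h

theorem Supermanifold.exists_glue (s : ∀ c : Chart M.toSuperSpace p q, M.Fn c.dom)
    (h : ∀ c c', M.res (inf_le_left : c.dom ⊓ c'.dom ≤ c.dom) (s c) =
      M.res (inf_le_right : c.dom ⊓ c'.dom ≤ c'.dom) (s c')) :
    ∃ f : M.C, ∀ c : Chart M.toSuperSpace p q, M.res (le_top : c.dom ≤ ⊤) f = s c :=
  (M.sheaf.existsUnique_gluing' (fun c : Chart M.toSuperSpace p q => c.dom) ⊤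
    (fun _ => homOfLE le_top) M.le_iSup_dom s h).exists

theorem SuperSpace.exists_even_add_odd {M : SuperSpace.{u}} {U : Opens M.carrier} (f : M.Fn U) :
    ∃ f₀ ∈ M.grading U 0, ∃ f₁ ∈ M.grading U 1, f = f₀ + f₁ := by
  refine ⟨_, SetLike.coe_mem (DirectSum.decompose (M.grading U) f 0), _,
    SetLike.coe_mem (DirectSum.decompose (M.grading U) f 1), ?_⟩
  classical
  conv_lhs => rw [← DirectSum.sum_support_decompose (M.grading U) f]
  rw [Finset.sum_subset (Finset.subset_univ _) (fun i _ hi => by simpa using hi)]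
  exact Fin.sum_univ_two _

theorem SuperSpace.eq_zero_of_even_of_odd {M : SuperSpace.{u}} {U : Opens M.carrier} {f : M.Fn U}
    (h0 : f ∈ M.grading U 0) (h1 : f ∈ M.grading U 1) : f = 0 := by
  rw [← DirectSum.decompose_of_mem_same _ h0, DirectSum.decompose_of_mem_ne _ h1 one_ne_zero]

theorem Supermanifold.even_of_res {f : M.C}
    (h : ∀ c : Chart M.toSuperSpace p q, M.res (le_top : c.dom ≤ ⊤) f ∈ M.grading c.dom 0) :
    f ∈ M.grading ⊤ 0 := by
  obtain ⟨f₀, h0, f₁, h1, rfl⟩ := SuperSpace.exists_even_add_odd f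
  have : f₁ = 0 := Supermanifold.eq_of_res_eq fun c => by
    rw [map_zero]
    refine SuperSpace.eq_zero_of_even_of_odd ?_ (SuperSpace.res_mem le_top 1 f₁ h1)
    have := sub_mem (h c) (SuperSpace.res_mem le_top 0 f₀ h0)
    rw [map_add] at this
    rwa [add_sub_cancel_left] at this
  rwa [this, add_zero]

theorem Supermanifold.isUnit_of_res {f : M.C}
    (h : ∀ c : Chart M.toSuperSpace p q, IsUnit (M.res (le_top : c.dom ≤ ⊤) f)) : IsUnit f := by
  have hinv : ∀ c c' : Chart M.toSuperSpace p q,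
      M.res (inf_le_left : c.dom ⊓ c'.dom ≤ c.dom) ↑(h c).unit⁻¹ =
        M.res (inf_le_right : c.dom ⊓ c'.dom ≤ c'.dom) ↑(h c').unit⁻¹ := by
    intro c c'
    have h1 : M.res (inf_le_left : c.dom ⊓ c'.dom ≤ c.dom) ↑(h c).unit⁻¹ *
        M.res le_top f = 1 := by
      rw [← SuperSpace.res_res le_top inf_le_left, ← map_mul, (h c).val_inv_mul, map_one]
    have h2 : M.res le_top f *
        M.res (inf_le_right : c.dom ⊓ c'.dom ≤ c'.dom) ↑(h c').unit⁻¹ = 1 := by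
      rw [← SuperSpace.res_res le_top inf_le_right, ← map_mul, (h c').mul_val_inv, map_one]
    exact left_inv_eq_right_inv h1 h2
  obtain ⟨g, hg⟩ := Supermanifold.exists_glue _ hinv
  refine isUnit_iff_exists.2 ⟨g, ?_, ?_⟩ <;> refine Supermanifold.eq_of_res_eq fun c => ?_
  · rw [map_mul, hg, map_one, (h c).mul_val_inv]
  · rw [map_mul, hg, map_one, (h c).val_inv_mul]

/-! ### Exponentials and logarithms of even functions on a supermanifold -/

theorem VectorField.act_res {k : ZMod 2} (X : VectorField M k) (f : M.C)
    (c : Chart M.toSuperSpace p q) :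
    M.res (le_top : c.dom ≤ ⊤) (X.act f) = ∑ a, X.app c.dom (c.coord c.dom le_rfl a) *
      c.pd c.dom le_rfl a (M.res le_top f) := by
  rw [← c.superDerivation_eq_sum le_rfl (X.isSuperDerivation c.dom), X.app_res]
  rfl

/-- A differential equation that holds for the partial derivatives of one chart holds for those of
another one on the overlap. -/
theorem Chart.pd_eq_of_pd_eq {M : SuperSpace.{u}} (c c' : Chart M p q) {U : Opens M.carrier}
    (hU : U ≤ c.dom) (hU' : U ≤ c'.dom) {f g h h' : M.Fn U}
    (H : ∀ a, c'.pd U hU' a f * h = c'.pd U hU' a g * h') (a : Idx p q) :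
    c.pd U hU a f * h = c.pd U hU a g * h' := by
  have hD := c.pd_isSuperDerivation hU a
  rw [c'.superDerivation_eq_sum hU' hD f, c'.superDerivation_eq_sum hU' hD g, Finset.sum_mul,
    Finset.sum_mul]
  exact Finset.sum_congr rfl fun b _ => by rw [mul_assoc, mul_assoc, H]

/-- The logarithm of an invertible even function: the logarithms in the charts satisfy the same
differential equations and have the same values on overlaps, so they glue. -/
theorem exists_log {h : M.C} (hh : h ∈ M.grading ⊤ 0) (hu : IsUnit h) :
    ∃ ψ ∈ M.grading ⊤ 0, ∀ {k : ZMod 2} (X : VectorField M k), X.act ψ * h = X.act h := by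
  choose ψ hψ0 hψ hψv using fun c : Chart M.toSuperSpace p q =>
    c.exists_log (le_refl c.dom) (SuperSpace.res_mem le_top 0 h hh) (hu.map (M.res le_top))
  have hres : ∀ (c : Chart M.toSuperSpace p q) (U : Opens M.carrier) (hU : U ≤ c.dom),
      (∀ a, c.pd U hU a (M.res hU (ψ c)) * M.res le_top h = c.pd U hU a (M.res le_top h)) ∧
      ∀ x, c.val U hU x (M.res hU (ψ c)) = Real.log (c.val U hU x (M.res le_top h)) := by
    intro c U hU
    refine ⟨fun a => ?_, fun x => ?_⟩
    · rw [← SuperSpace.res_res le_top hU, c.pd_res le_rfl hU, c.pd_res le_rfl hU, ← map_mul]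
      exact congrArg _ (hψ c a)
    · rw [← SuperSpace.res_res le_top hU, c.val_res le_rfl hU, c.val_res le_rfl hU]
      exact hψv c _
  obtain ⟨Ψ, hΨ⟩ := Supermanifold.exists_glue ψ fun c c' => by
    obtain ⟨h1, h2⟩ := hres c _ (inf_le_left : c.dom ⊓ c'.dom ≤ c.dom)
    obtain ⟨h1', h2'⟩ := hres c' _ (inf_le_right : c.dom ⊓ c'.dom ≤ c'.dom)
    refine c.log_unique inf_le_left (hu.map (M.res le_top)) h1 (fun a => ?_) fun x => ?_
    · have := c.pd_eq_of_pd_eq c' inf_le_left inf_le_right (h' := 1)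
        (fun a => (h1' a).trans (mul_one _).symm) a
      rwa [mul_one] at this
    · rw [h2, c.val_eq c' inf_le_left inf_le_right, c.val_eq c' inf_le_left inf_le_right, h2']
  refine ⟨Ψ, Supermanifold.even_of_res fun c => by rw [hΨ]; exact hψ0 c, fun X => ?_⟩
  refine Supermanifold.eq_of_res_eq fun c => ?_
  rw [map_mul, X.act_res, X.act_res, hΨ, Finset.sum_mul]
  exact Finset.sum_congr rfl fun a _ => by rw [mul_assoc, hψ]

/-- The exponential of an even function, glued from the exponentials in the charts. -/
theorem exists_exp {f : M.C} (hf : f ∈ M.grading ⊤ 0) :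
    ∃ e ∈ M.grading ⊤ 0, IsUnit e ∧
      ∀ {k : ZMod 2} (X : VectorField M k), X.act e = X.act f * e := by
  choose e he0 he hev using fun c : Chart M.toSuperSpace p q =>
    c.exists_exp (le_refl c.dom) (SuperSpace.res_mem le_top 0 f hf)
  have heu : ∀ c, IsUnit (e c) := fun c =>
    c.isUnit_of_val_ne_zero le_rfl fun x => by rw [hev]; exact Real.exp_ne_zero _
  have hres : ∀ (c : Chart M.toSuperSpace p q) (U : Opens M.carrier) (hU : U ≤ c.dom),
      (∀ a, c.pd U hU a (M.res hU (e c)) = c.pd U hU a (M.res le_top f) * M.res hU (e c)) ∧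
      ∀ x, c.val U hU x (M.res hU (e c)) = Real.exp (c.val U hU x (M.res le_top f)) := by
    intro c U hU
    refine ⟨fun a => ?_, fun x => ?_⟩
    · rw [← SuperSpace.res_res le_top hU, c.pd_res le_rfl hU, c.pd_res le_rfl hU, ← map_mul]
      exact congrArg _ (he c a)
    · rw [← SuperSpace.res_res le_top hU, c.val_res le_rfl hU, c.val_res le_rfl hU]
      exact hev c _
  obtain ⟨e', he'⟩ := Supermanifold.exists_glue e fun c c' => by
    obtain ⟨h1, h2⟩ := hres c _ (inf_le_left : c.dom ⊓ c'.dom ≤ c.dom)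
    obtain ⟨h1', h2'⟩ := hres c' _ (inf_le_right : c.dom ⊓ c'.dom ≤ c'.dom)
    refine c.exp_unique inf_le_left (SuperSpace.res_mem _ _ _ (he0 c)) (SuperSpace.res_mem _ _ _ (he0 c'))
      ((heu c').map (M.res _)) h1 (fun a => ?_) fun x => ?_
    · have := c.pd_eq_of_pd_eq c' inf_le_left inf_le_right (h := 1)
        (fun a => (mul_one _).trans (h1' a)) a
      rwa [mul_one] at this
    · rw [h2, c.val_eq c' inf_le_left inf_le_right, c.val_eq c' inf_le_left inf_le_right, h2']
  refine ⟨e', Supermanifold.even_of_res fun c => by rw [he']; exact he0 c,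
    Supermanifold.isUnit_of_res fun c => by rw [he']; exact heu c, fun X => ?_⟩
  refine Supermanifold.eq_of_res_eq fun c => ?_
  rw [map_mul, X.act_res, X.act_res, he', Finset.sum_mul]
  exact Finset.sum_congr rfl fun a _ => by rw [mul_assoc, ← he]

end Gluing

/-! ### Berezin volumes and divergences -/

section Divergence

variable {p q : ℕ} {M : Supermanifold.{u} p q}

/-- The product of a Berezin volume with an invertible even function. -/
def BerezinVolume.smul (h : M.C) (hh : h ∈ M.grading ⊤ 0) (hu : IsUnit h) (ρ : BerezinVolume M) :
    BerezinVolume M where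
  coeff c := M.res le_top h * ρ.coeff c
  even c := by simpa using SetLike.mul_mem_graded (SuperSpace.res_mem le_top 0 h hh) (ρ.even c)
  isUnit c := (hu.map (M.res le_top)).mul (ρ.isUnit c)
  compat c c' := by
    rw [map_mul, map_mul, SuperSpace.res_res, SuperSpace.res_res, ρ.compat c c', ← mul_assoc,
      ← mul_assoc, SuperSpace.even_comm (SuperSpace.res_mem le_top 0 h hh)]

/-- Two Berezin volumes differ by an invertible even function: on overlaps of charts, their
coefficients transform with the same Berezinian, so the quotients of the coefficients glue. -/
theorem BerezinVolume.exists_eq_smul (ρ ρ' : BerezinVolume M) :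
    ∃ (h : M.C) (hh : h ∈ M.grading ⊤ 0) (hu : IsUnit h), ρ' = ρ.smul h hh hu := by
  choose g hg using fun c => (ρ.isUnit c).exists_right_inv
  have hg0 : ∀ c, g c ∈ M.grading c.dom 0 := fun c =>
    SuperSpace.even_of_mul_eq_one (ρ.even c) (hg c)
  have hgu : ∀ c, IsUnit (g c) := fun c =>
    isUnit_iff_exists.2 ⟨ρ.coeff c, SuperSpace.even_comm (hg0 c) _ ▸ hg c, hg c⟩
  have hcoeff : ∀ c, ρ'.coeff c * g c * ρ.coeff c = ρ'.coeff c := fun c => by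
    rw [mul_assoc, SuperSpace.even_comm (hg0 c), hg, mul_one]
  obtain ⟨h, hh⟩ := Supermanifold.exists_glue (fun c => ρ'.coeff c * g c) fun c c' => by
    refine ((ρ.isUnit c).map (M.res inf_le_left)).mul_right_cancel ?_
    rw [← map_mul, hcoeff, ρ'.compat c c', ρ.compat c c', ← mul_assoc,
      SuperSpace.even_comm (f := M.res inf_le_right (ρ'.coeff c' * g c')) (SuperSpace.res_mem _ _ _
        (by simpa using SetLike.mul_mem_graded (ρ'.even c') (hg0 c'))), mul_assoc, ← map_mul,
      hcoeff]
  have h0 : h ∈ M.grading ⊤ 0 := Supermanifold.even_of_res fun c => by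
    rw [hh]; simpa using SetLike.mul_mem_graded (ρ'.even c) (hg0 c)
  have hu : IsUnit h := Supermanifold.isUnit_of_res fun c => by
    rw [hh]; exact (ρ'.isUnit c).mul (hgu c)
  refine ⟨h, h0, hu, ?_⟩
  obtain ⟨r, _, _, _⟩ := ρ'
  have : r = (ρ.smul h h0 hu).coeff := funext fun c => by
    change _ = M.res le_top h * ρ.coeff c
    rw [hh]
    exact (hcoeff c).symm
  subst this
  rfl

theorem lieCoeff_smul {k : ZMod 2} (X : VectorField M k) (h : M.C) (hh : h ∈ M.grading ⊤ 0)
    (hu : IsUnit h) (ρ : BerezinVolume M) (c : Chart M.toSuperSpace p q) :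
    lieCoeff X (ρ.smul h hh hu) c =
      lieCoeff X ρ c * M.res le_top h + ρ.coeff c * M.res le_top (X.act h) := by
  have hsgn : ∀ k a : ZMod 2, a * (k + 1) + a * (k + a) = 0 := by decide
  have hr := SuperSpace.res_mem (le_top : c.dom ≤ ⊤) 0 h hh
  rw [X.act_res, Finset.mul_sum, lieCoeff, lieCoeff, Finset.sum_mul, ← Finset.sum_add_distrib]
  refine Finset.sum_congr rfl fun a _ => ?_
  have hX := X.app_mem c.dom a.parity _ (c.coord_mem le_rfl a)
  have hXρ : X.app c.dom (c.coord c.dom le_rfl a) * ρ.coeff c ∈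
      M.grading c.dom (k + a.parity) := by
    simpa using SetLike.mul_mem_graded hX (ρ.even c)
  change sgn _ • c.pd c.dom le_rfl a (_ * (M.res le_top h * ρ.coeff c)) = _
  rw [SuperSpace.even_comm hr, ← mul_assoc, (c.pd_isSuperDerivation le_rfl a).leibniz _ _ _ hXρ,
    smul_add, smul_mul_assoc, smul_smul, ← sgn_add, hsgn, sgn_zero, one_smul,
    ← mul_assoc (ρ.coeff c), SuperSpace.even_comm (ρ.even c)]

/-- The divergence with respect to the product of a Berezin volume with an even function `h`
changes by the logarithmic derivative of `h`. -/
theorem HasDiv.smul {k : ZMod 2} {X : VectorField M k} {ρ : BerezinVolume M} {f g h : M.C}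
    (hf : HasDiv ρ X f) (hh : h ∈ M.grading ⊤ 0) (hu : IsUnit h) (hg : X.act h = g * h) :
    HasDiv (ρ.smul h hh hu) X (f + g) := by
  intro c
  have hr := SuperSpace.res_mem (le_top : c.dom ≤ ⊤) 0 h hh
  rw [lieCoeff_smul, hf c, hg, map_mul, map_add]
  change _ = M.res le_top h * ρ.coeff c * _
  rw [mul_assoc (M.res _ h), SuperSpace.even_comm (f := M.res _ h) hr, mul_add, add_mul,
    ← mul_assoc]

theorem HasDiv.unique {k : ZMod 2} {X : VectorField M k} {ρ : BerezinVolume M} {f g : M.C}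
    (hf : HasDiv ρ X f) (hg : HasDiv ρ X g) : f = g :=
  Supermanifold.eq_of_res_eq fun c => (ρ.isUnit c).mul_left_cancel ((hf c).symm.trans (hg c))

theorem lieCoeff_mem {k : ZMod 2} (X : VectorField M k) (ρ : BerezinVolume M)
    (c : Chart M.toSuperSpace p q) : lieCoeff X ρ c ∈ M.grading c.dom k := by
  refine sum_mem fun a _ => Submodule.smul_mem _ _ ?_
  have h := (c.pd_isSuperDerivation le_rfl a).mem _ _
    (SetLike.mul_mem_graded (X.app_mem c.dom a.parity _ (c.coord_mem le_rfl a)) (ρ.even c))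
  have hp : ∀ a k : ZMod 2, a + (k + a + 0) = k := by decide
  rwa [hp] at h

/-- If the divergence of an odd vector field `Q` is `Q`-exact, it is the image of an even
function. -/
theorem HasDiv.exists_even {Q : VectorField M 1} {ρ : BerezinVolume M} {g : M.C}
    (h : HasDiv ρ Q (Q.act g)) : ∃ g₀ ∈ M.grading ⊤ 0, HasDiv ρ Q (Q.act g₀) := by
  obtain ⟨g₀, h0, g₁, h1, rfl⟩ := SuperSpace.exists_even_add_odd g
  refine ⟨g₀, h0, fun c => ?_⟩
  have h2 := h c
  rw [map_add, map_add, mul_add] at h2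
  have hρ : ∀ {i : ZMod 2} {f : M.C}, f ∈ M.grading ⊤ i →
      ρ.coeff c * M.res le_top f ∈ M.grading c.dom i := fun {i f} hf => by
    simpa using SetLike.mul_mem_graded (ρ.even c) (SuperSpace.res_mem le_top i f hf)
  have he : ρ.coeff c * M.res le_top (Q.act g₁) ∈ M.grading c.dom 0 :=
    hρ (Q.app_mem ⊤ 1 g₁ h1)
  have ho : ρ.coeff c * M.res le_top (Q.act g₁) ∈ M.grading c.dom 1 := by
    have h3 := sub_mem (lieCoeff_mem Q ρ c) (hρ (f := Q.act g₀) (i := 1) (Q.app_mem ⊤ 0 g₀ h0))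
    rw [h2] at h3
    rwa [add_sub_cancel_left] at h3
  rw [h2, SuperSpace.eq_zero_of_even_of_odd he ho, add_zero]

theorem isModularClass_zero_iff {Q : VectorField M 1} (hQ : Q.app ⊤ ∘ₗ Q.app ⊤ = 0)
    (ρ : BerezinVolume M) : IsModularClass ρ Q 0 ↔ ∃ g, HasDiv ρ Q (Q.act g) := by
  constructor
  · rintro ⟨f, hf, h0⟩
    obtain ⟨g, hg⟩ := (Submodule.Quotient.mk_eq_zero _).1 h0.symm
    exact ⟨g, by rw [show Q.act g = f from hg]; exact hf⟩
  · rintro ⟨g, hg⟩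
    refine ⟨⟨Q.act g, LinearMap.mem_ker.2 (LinearMap.congr_fun hQ g)⟩, hg, ?_⟩
    exact ((Submodule.Quotient.mk_eq_zero ((LinearMap.range Q.act).submoduleOf _)).2
      (LinearMap.mem_range_self Q.act g)).symm

/-- Multiplication of a Berezin volume with `exp (-ψ)` subtracts `X ψ` from the divergence of every
vector field `X`. -/
theorem BerezinVolume.exists_hasDiv_sub (ρ : BerezinVolume M) {ψ : M.C} (hψ : ψ ∈ M.grading ⊤ 0) :
    ∃ ρ' : BerezinVolume M, ∀ {k : ZMod 2} {X : VectorField M k} {f : M.C},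
      HasDiv ρ X f → HasDiv ρ' X (f - X.act ψ) := by
  obtain ⟨e, he, hu, hX⟩ := exists_exp (neg_mem hψ)
  refine ⟨ρ.smul e he hu, fun {k X f} hf => ?_⟩
  have := hf.smul he hu (hX X)
  rwa [map_neg, ← sub_eq_add_neg] at this

/-- The divergences with respect to two Berezin volumes differ by the derivative of the logarithm
of their quotient. -/
theorem BerezinVolume.exists_hasDiv_add (ρ ρ' : BerezinVolume M) :
    ∃ ψ ∈ M.grading ⊤ 0, ∀ {k : ZMod 2} {X : VectorField M k} {f : M.C},
      HasDiv ρ X f → HasDiv ρ' X (f + X.act ψ) := by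
  obtain ⟨h, hh, hu, rfl⟩ := ρ.exists_eq_smul ρ'
  obtain ⟨ψ, hψ, hX⟩ := exists_log hh hu
  exact ⟨ψ, hψ, fun {k X f} hf => hf.smul hh hu (hX X).symm⟩

theorem isModularClass_zero_iff_exists_hasDiv_zero {Q : VectorField M 1}
    (hQ : Q.app ⊤ ∘ₗ Q.app ⊤ = 0) (ρ : BerezinVolume M) :
    IsModularClass ρ Q 0 ↔ ∃ ρ' : BerezinVolume M, HasDiv ρ' Q 0 := by
  rw [isModularClass_zero_iff hQ]
  constructor
  · rintro ⟨g, hg⟩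
    obtain ⟨g₀, h0, hg₀⟩ := hg.exists_even
    obtain ⟨ρ', hρ'⟩ := ρ.exists_hasDiv_sub h0
    exact ⟨ρ', by simpa using hρ' hg₀⟩
  · rintro ⟨ρ', hρ'⟩
    obtain ⟨ψ, -, hψ⟩ := ρ'.exists_hasDiv_add ρ
    exact ⟨ψ, by simpa using hψ hρ'⟩

end Divergence

end SuperGeom

end

theorem theorem1 {p q : ℕ} (M : SuperGeom.Supermanifold.{u} p q)
    (Q₁ Q₂ : SuperGeom.VectorField M 1) (P : SuperGeom.VectorField M 0)
    (hQ : SuperGeom.IsSupertranslation Q₁ Q₂ P) (ρ : SuperGeom.BerezinVolume M) :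
    (SuperGeom.IsModularClass ρ Q₁ 0 ↔
      ∃ ρ₁ : SuperGeom.BerezinVolume M, SuperGeom.HasDiv ρ₁ Q₁ 0) ∧
    (SuperGeom.IsModularClass ρ Q₂ 0 ↔
      ∃ ρ₂ : SuperGeom.BerezinVolume M, SuperGeom.HasDiv ρ₂ Q₂ 0) ∧
    ∀ ρ₁ ρ₂ : SuperGeom.BerezinVolume M,
      SuperGeom.HasDiv ρ₁ Q₁ 0 → SuperGeom.HasDiv ρ₂ Q₂ 0 →
      ((∃ ρ' : SuperGeom.BerezinVolume M,
          SuperGeom.HasDiv ρ' Q₁ 0 ∧ SuperGeom.HasDiv ρ' Q₂ 0) ↔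
        ∃ ψ : M.C, ψ ∈ M.grading ⊤ 0 ∧
          SuperGeom.HasDiv ρ₁ Q₂ (Q₂.act ψ) ∧ Q₁.act ψ = 0) := by
  refine ⟨SuperGeom.isModularClass_zero_iff_exists_hasDiv_zero (hQ.sq₁ ⊤) ρ,
    SuperGeom.isModularClass_zero_iff_exists_hasDiv_zero (hQ.sq₂ ⊤) ρ,
    fun ρ₁ ρ₂ h₁ _ => ⟨?_, ?_⟩⟩
  · rintro ⟨ρ', h₁', h₂'⟩
    obtain ⟨ψ, hψ, hdiv⟩ := ρ'.exists_hasDiv_add ρ₁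
    exact ⟨ψ, hψ, by simpa using hdiv h₂', by simpa using (hdiv h₁').unique h₁⟩
  · rintro ⟨ψ, hψ, h₂, hQψ⟩
    obtain ⟨ρ', hdiv⟩ := ρ₁.exists_hasDiv_sub hψ
    exact ⟨ρ', by simpa [hQψ] using hdiv h₁, by simpa using hdiv h₂⟩
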